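/- Let $W=W(3,2,2)$ be a smooth three-web on a smooth $4$-dimensional manifold $M$, i.e. three foliations of codimension $2$ whose leaves are in general position (the tangent planes of leaves of two different foliations meet only in $0$). A \emph{transversal bivector} at a point $x$ is a $2$-dimensional subspace of $T_xM$ that meets the tangent plane of each of the three leaves through $x$ along a line; $W$ is \emph{transversally geodesic} if every transversal bivector, at every point $x$, is the tangent plane at $x$ of a smooth surface through $x$ all of whose tangent planes are transversal bivectors. $W$ is a \emph{group web} if it is locally equivalent to the web formed by the foliations $g_1=\mathrm{const}$, $g_2=\mathrm{const}$, $g_1g_2=\mathrm{const}$ on $G\times G$, for some $2$-dimensional Lie group $G$. Let $\omega_1^i,\omega_2^i$ ($i=1,2$) be smooth one-forms on a coordinate domain $U\subseteq M$ such that the three foliations are given there by $\omega_1^i=0$, by $\omega_2^i=0$ and by $\omega_1^i+\omega_2^i=0$ (an adapted coframe). Let the forms $\omega_j^i$ and the functions $a_j$, $b^i_{jkl}$, $p_{ij}$, $q_{ij}$ on $U$ be determined by $$d\omega_1^i=\omega_1^j\wedge\omega_j^i+a_j\,\omega_1^j\wedge\omega_1^i,\qquad d\omega_2^i=\omega_2^j\wedge\omega_j^i-a_j\,\omega_2^j\wedge\omega_2^i,$$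 $$d\omega_j^i-\omega_j^k\wedge\omega_k^i=b^i_{jkl}\,\omega_1^k\wedge\omega_2^l,\qquad da_i-a_j\omega_i^j=p_{ij}\,\omega_1^j+q_{ij}\,\omega_2^j,$$ and put $p=\tfrac12(p_{12}-p_{21})$, $q=\tfrac12(q_{12}-q_{21})$. The web is \emph{nonisoclinic} at a point if $p^2+q^2>0$ there. (a) If some component $b^i_{jjj}$ with $i\neq j$ is nonzero at some point of $U$, then $W$ is not transversally geodesic. (b) Suppose that $W$ is nonisoclinic at some point of $U$ and is not a group web. If $b^1_{jkl}=0$ on $U$ for all $j,k,l$, or $b^2_{jkl}=0$ on $U$ for all $j,k,l$, then $W$ is not transversally geodesic. -/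

import Mathlib

open scoped Manifold ContDiff Topology

noncomputable section

/-- The model space of the four-dimensional manifold that carries the web. -/
abbrev R4 : Type := EuclideanSpace ℝ (Fin 4)

/-- The plane: target of the local first integrals, parameter space of surfaces. -/
abbrev R2 : Type := EuclideanSpace ℝ (Fin 2)

/-- A three-web `W(3,2,2)` on a smooth four-dimensional manifold `M`: three foliations of
codimension two in general position.  A foliation is given by its tangent distribution, which
is locally the kernel of the differential of a smooth submersion onto the plane (the leaves are
locally the level sets of this submersion).  General position: the tangent planes of leaves of
different foliations meet only in `0`. -/
structure ThreeWeb (M : Type*) [TopologicalSpace M] [ChartedSpace R4 M] where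
  /-- tangent distribution of the foliation with the number `ξ` -/
  dist : Fin 3 → ∀ x : M, Submodule ℝ (TangentSpace 𝓘(ℝ, R4) x)
  foliation : ∀ (ξ : Fin 3) (x : M), ∃ (V : Set M) (u : M → R2),
    IsOpen V ∧ x ∈ V ∧ ContMDiffOn 𝓘(ℝ, R4) 𝓘(ℝ, R2) ∞ u V ∧
    ∀ y ∈ V, Function.Surjective (mfderiv 𝓘(ℝ, R4) 𝓘(ℝ, R2) u y) ∧
      ∀ v : TangentSpace 𝓘(ℝ, R4) y,
        v ∈ dist ξ y ↔ mfderiv 𝓘(ℝ, R4) 𝓘(ℝ, R2) u y v = 0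
  transversal : ∀ (x : M) (ξ η : Fin 3), ξ ≠ η → Disjoint (dist ξ x) (dist η x)

namespace ThreeWeb

variable {M : Type*} [TopologicalSpace M] [ChartedSpace R4 M]

/-- A transversal bivector at `x`: a two-dimensional subspace of the tangent space that meets the
tangent plane of each of the three leaves through `x` along a line.  In terms of a coframe with
`ω₃ = -(ω₁ + ω₂)` these are exactly the planes
`ξ² ω₁¹ - ξ¹ ω₁² = 0`, `ξ² ω₂¹ - ξ¹ ω₂² = 0` with `ξ ≠ 0`. -/
def IsTransversalBivector (W : ThreeWeb M) (x : M)
    (P : Submodule ℝ (TangentSpace 𝓘(ℝ, R4) x)) : Prop :=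
  Module.finrank ℝ P = 2 ∧
    ∀ ξ : Fin 3, Module.finrank ℝ (P ⊓ W.dist ξ x : Submodule ℝ (TangentSpace 𝓘(ℝ, R4) x)) = 1

/-- `s`, on the open set `N` of parameters, is a (smooth, immersed) transversally geodesic surface:
all its tangent planes are transversal bivectors, that is, the three foliations cut
on it a two-dimensional three-web of curves. -/
def IsTransversallyGeodesicSurface (W : ThreeWeb M) (N : Set R2) (s : R2 → M) : Prop :=
  ContMDiffOn 𝓘(ℝ, R2) 𝓘(ℝ, R4) ∞ s N ∧
    ∀ t ∈ N, W.IsTransversalBivector (s t)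
      (LinearMap.range (mfderiv 𝓘(ℝ, R2) 𝓘(ℝ, R4) s t).toLinearMap)

/-- A web is transversally geodesic if every transversal bivector, at every point, is tangent to a
transversally geodesic surface through this point. -/
def IsTransversallyGeodesic (W : ThreeWeb M) : Prop :=
  ∀ (x : M) (P : Submodule ℝ (TangentSpace 𝓘(ℝ, R4) x)), W.IsTransversalBivector x P →
    ∃ (N : Set R2) (s : R2 → M) (hs : x = s 0), IsOpen N ∧ (0 : R2) ∈ N ∧
      W.IsTransversallyGeodesicSurface N s ∧
      LinearMap.range (mfderiv 𝓘(ℝ, R2) 𝓘(ℝ, R4) s 0).toLinearMap = hs ▸ P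

/-- A group web: locally equivalent to the web that the foliations `g₁ = const`, `g₂ = const`,
`g₁ g₂ = const` form on `G × G`, for a two-dimensional Lie group `G`. -/
def IsGroupWeb (W : ThreeWeb M) : Prop :=
  ∀ x : M, ∃ (G : Type) (_ : TopologicalSpace G) (_ : ChartedSpace R2 G) (_ : Group G)
    (_ : LieGroup 𝓘(ℝ, R2) ∞ G) (V : Set M) (g₁ g₂ : M → G),
    IsOpen V ∧ x ∈ V ∧
    ContMDiffOn 𝓘(ℝ, R4) 𝓘(ℝ, R2) ∞ g₁ V ∧ ContMDiffOn 𝓘(ℝ, R4) 𝓘(ℝ, R2) ∞ g₂ V ∧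
    ∀ y ∈ V, ∀ v : TangentSpace 𝓘(ℝ, R4) y,
      (v ∈ W.dist 0 y ↔ mfderiv 𝓘(ℝ, R4) 𝓘(ℝ, R2) g₁ y v = 0) ∧
      (v ∈ W.dist 1 y ↔ mfderiv 𝓘(ℝ, R4) 𝓘(ℝ, R2) g₂ y v = 0) ∧
      (v ∈ W.dist 2 y ↔ mfderiv 𝓘(ℝ, R4) 𝓘(ℝ, R2) (fun z => g₁ z * g₂ z) y v = 0)

/-- An adapted coframe of a web on a coordinate domain: in a chart of the smooth structure,
one-forms `ω₁ⁱ` (`form 0 i`) and `ω₂ⁱ` (`form 1 i`), `i = 1, 2`, such that the three foliations are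
defined by `ω₁ⁱ = 0`, by `ω₂ⁱ = 0`, and by `ω₃ⁱ = 0`, where `ω₁ⁱ + ω₂ⁱ + ω₃ⁱ = 0`. -/
structure AdaptedCoframe (W : ThreeWeb M) where
  chart : OpenPartialHomeomorph M R4
  chart_mem : chart ∈ IsManifold.maximalAtlas 𝓘(ℝ, R4) ∞ M
  form : Fin 2 → Fin 2 → R4 → R4 →L[ℝ] ℝ
  smooth : ∀ α i, ContDiffOn ℝ ∞ (form α i) chart.target
  mem_dist₁ : ∀ x ∈ chart.source, ∀ v : TangentSpace 𝓘(ℝ, R4) x, v ∈ W.dist 0 x ↔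
    ∀ i, form 0 i (chart x) (mfderiv 𝓘(ℝ, R4) 𝓘(ℝ, R4) chart x v) = 0
  mem_dist₂ : ∀ x ∈ chart.source, ∀ v : TangentSpace 𝓘(ℝ, R4) x, v ∈ W.dist 1 x ↔
    ∀ i, form 1 i (chart x) (mfderiv 𝓘(ℝ, R4) 𝓘(ℝ, R4) chart x v) = 0
  mem_dist₃ : ∀ x ∈ chart.source, ∀ v : TangentSpace 𝓘(ℝ, R4) x, v ∈ W.dist 2 x ↔
    ∀ i, -(form 0 i (chart x) + form 1 i (chart x)) (mfderiv 𝓘(ℝ, R4) 𝓘(ℝ, R4) chart x v) = 0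

/-- Exterior differential of a one-form on a domain of `ℝ⁴`:
`dθ(u, v) = (D_u θ)(v) - (D_v θ)(u)`. -/
def extD (θ : R4 → R4 →L[ℝ] ℝ) (y u v : R4) : ℝ :=
  fderiv ℝ θ y u v - fderiv ℝ θ y v u

/-- Exterior product of covectors, evaluated on two vectors. -/
def wedge (φ ψ : R4 →L[ℝ] ℝ) (u v : R4) : ℝ := φ u * ψ v - φ v * ψ u

namespace AdaptedCoframe

variable {W : ThreeWeb M} (C : W.AdaptedCoframe)

/-- The coframe at `y` as a map `ℝ⁴ → (ℝ²)²` (an isomorphism at each point of the domain). -/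
def coframeMap (y : R4) : R4 →L[ℝ] (Fin 2 → Fin 2 → ℝ) :=
  ContinuousLinearMap.pi fun α => ContinuousLinearMap.pi fun i => C.form α i y

/-- The dual frame: `form β j (frame α k) = 1` if `(β, j) = (α, k)`, and `0` otherwise. -/
def frame (α k : Fin 2) (y : R4) : R4 :=
  (C.coframeMap y).inverse (Pi.single α (Pi.single k 1))

/-- The connection forms `ω_jⁱ` of the web (`conn j i`).  They and the covector `a` are the unique
solution of
`dω₁ⁱ = ω₁ʲ ∧ ω_jⁱ + a_j ω₁ʲ ∧ ω₁ⁱ`, `dω₂ⁱ = ω₂ʲ ∧ ω_jⁱ - a_j ω₂ʲ ∧ ω₂ⁱ`: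
the equations give `ω_jⁱ(e_{1k}) = dω₂ⁱ(e_{2j}, e_{1k})`, `ω_jⁱ(e_{2k}) = dω₁ⁱ(e_{1j}, e_{2k})`. -/
def conn (j i : Fin 2) (y : R4) : R4 →L[ℝ] ℝ :=
  ∑ k, (extD (C.form 1 i) y (C.frame 1 j y) (C.frame 0 k y) • C.form 0 k y
    + extD (C.form 0 i) y (C.frame 0 j y) (C.frame 1 k y) • C.form 1 k y)

/-- The covector `a_j`: the first structure equation gives
`a_j δⁱ_k - a_k δⁱ_j = (dω₁ⁱ - ω₁ᵐ ∧ ω_mⁱ)(e_{1j}, e_{1k})`; contract `i` with `k`. -/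
def a (j : Fin 2) (y : R4) : ℝ :=
  ∑ k, (extD (C.form 0 k) y (C.frame 0 j y) (C.frame 0 k y)
    - ∑ m, wedge (C.form 0 m y) (C.conn m k y) (C.frame 0 j y) (C.frame 0 k y))

/-- The curvature tensor `bⁱ_{jkl}` (`b i j k l`), the coefficients in
`dω_jⁱ - ω_jᵐ ∧ ω_mⁱ = bⁱ_{jkl} ω₁ᵏ ∧ ω₂ˡ`. -/
def b (i j k l : Fin 2) (y : R4) : ℝ :=
  extD (C.conn j i) y (C.frame 0 k y) (C.frame 1 l y)
    - ∑ m, wedge (C.conn j m y) (C.conn m i y) (C.frame 0 k y) (C.frame 1 l y)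

/-- The Pfaffian derivatives `p_{ij}` of the covector `a`, the coefficients of `ω₁ʲ` in
`da_i - a_m ω_iᵐ = p_{ij} ω₁ʲ + q_{ij} ω₂ʲ`. -/
def p (i j : Fin 2) (y : R4) : ℝ :=
  fderiv ℝ (C.a i) y (C.frame 0 j y) - ∑ m, C.a m y * C.conn i m y (C.frame 0 j y)

/-- The Pfaffian derivatives `q_{ij}` of the covector `a`, the coefficients of `ω₂ʲ` in
`da_i - a_m ω_iᵐ = p_{ij} ω₁ʲ + q_{ij} ω₂ʲ`. -/
def q (i j : Fin 2) (y : R4) : ℝ :=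
  fderiv ℝ (C.a i) y (C.frame 1 j y) - ∑ m, C.a m y * C.conn i m y (C.frame 1 j y)

/-- The web is nonisoclinic at the point with coordinates `y`: `p² + q² > 0`, where
`p = p_{[12]}` and `q = q_{[12]}`. -/
def IsNonisoclinicAt (y : R4) : Prop :=
  0 < ((C.p 0 1 y - C.p 1 0 y) / 2) ^ 2 + ((C.q 0 1 y - C.q 1 0 y) / 2) ^ 2

end AdaptedCoframe

end ThreeWeb

end

/-! The pull-back to a transversally geodesic surface makes all `ω_ξⁱ` proportional to a common
direction `ζⁱ`. Normalize one component of `ζ` to `1`: the structure equations then say that the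
covariant derivative of `ζ` is a multiple of `ζ`, hence so is its curvature, i.e. the vector
`bⁱ_{jkl} ζʲ ζᵏ ζˡ` is parallel to `ζ`. In a transversally geodesic web this holds for every
direction, and taking a coordinate direction gives (a).

For (b), renumber the indices so that `b¹ = 0`. Then the cubic form `b²_{jkl} ζʲ ζᵏ ζˡ` vanishes,
so the Bianchi identities express `b²` through the Pfaffian derivatives of `a₁`, and those of `a₂`
vanish. Near a point where `p₁₂² + q₁₂² ≠ 0` the differentials of these relations force `ω₂¹ = 0`
and `a₂ = 0`. All second covariant derivatives of `a₁` are then expressed through four of them,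
and the Ricci identities leave one relation between the first and second ones. Its repeated
derivatives along the frame vectors dual to `ω₁²` and `ω₂²` force the mixed second derivative `B`
of `a₁` in these two directions to vanish; since the Ricci identities express the derivatives of
`B` through `B`, `p₁₂` and `q₁₂`, it follows that `p₁₂² = q₁₂²` and `q₁₂⁴ = 0`, a contradiction. -/

noncomputable section

/-- The components of the exterior product of the one-forms with components `φ` and `ψ` in a moving
frame. -/
def MovingFrame.wedge {A ι : Type*} [CommRing A] (φ ψ : ι → A) (i j : ι) : A :=
  φ i * ψ j - φ j * ψ i

local infixl:70 "⋏" => MovingFrame.wedge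

/-- The components of the exterior product of the one-form `φ` and the two-form `T`. -/
def MovingFrame.wedge₂ {A ι : Type*} [CommRing A] (φ : ι → A) (T : ι → ι → A) (i j k : ι) : A :=
  φ i * T j k + φ j * T k i + φ k * T i j

section MovingFrames

variable {R A ι : Type*} [CommRing R] [CommRing A] [Algebra R A] [Fintype ι]

lemma derivation_sum_smul_apply (c : ι → A) (D : ι → Derivation R A A) (f : A) :
    (∑ i, c i • D i) f = ∑ i, c i * D i f := by
  rw [← Derivation.coeFnAddMonoidHom_apply, map_sum, Finset.sum_apply]
  rfl

/-- A moving frame on the ring of functions `A`: linearly independent derivations `e i` whose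
brackets are combinations of them, with the structure functions `c`. -/
structure MovingFrame (R A ι : Type*) [CommRing R] [CommRing A] [Algebra R A] [Fintype ι] where
  e : ι → Derivation R A A
  c : ι → ι → ι → A
  lie_e (i j : ι) : ⁅e i, e j⁆ = ∑ k, c i j k • e k
  independent (f : ι → A) (h : ∑ k, f k • e k = 0) (k : ι) : f k = 0

namespace MovingFrame

section

variable {A ι κ ρ : Type*} [CommRing A]

@[simp]
lemma wedge_zero (φ : ι → A) : φ ⋏ 0 = 0 := by
  ext
  simp [wedge]

@[simp]
lemma wedge₂_zero (φ : ι → A) : wedge₂ φ 0 = 0 := by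
  ext
  simp [wedge₂]

@[simp]
lemma zero_wedge₂ (T : ι → ι → A) : wedge₂ 0 T = 0 := by
  ext
  simp [wedge₂]

lemma wedge₂_add (φ : ι → A) (S T : ι → ι → A) : wedge₂ φ (S + T) = wedge₂ φ S + wedge₂ φ T := by
  ext i j k
  simp only [wedge₂, Pi.add_apply]
  ring

lemma wedge₂_sum (s : Finset κ) (φ : ι → A) (T : κ → ι → ι → A) :
    wedge₂ φ (∑ x ∈ s, T x) = ∑ x ∈ s, wedge₂ φ (T x) := by
  ext i j k
  simp only [wedge₂, Finset.sum_apply, Finset.mul_sum, Finset.sum_add_distrib]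

lemma wedge₂_wedge (φ ψ χ : ι → A) : wedge₂ χ (φ ⋏ ψ) = wedge₂ φ (ψ ⋏ χ) := by
  ext i j k
  simp only [wedge₂, wedge]
  ring

variable [DecidableEq κ] [DecidableEq ρ]

/-- The connection forms on a tensor product. -/
def tensorConn (Θ : κ → κ → ι → A) (Φ : ρ → ρ → ι → A) (x y : κ × ρ) : ι → A :=
  (if x.2 = y.2 then Θ x.1 y.1 else 0) + if x.1 = y.1 then Φ x.2 y.2 else 0

lemma sum_mul_tensorConn [Fintype κ] [Fintype ρ] (Θ : κ → κ → ι → A) (Φ : ρ → ρ → ι → A)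
    (f : κ × ρ → A) (x : κ × ρ) (i : ι) :
    ∑ z, f z * tensorConn Θ Φ x z i =
      ∑ y, f (y, x.2) * Θ x.1 y i + ∑ v, f (x.1, v) * Φ x.2 v i := by
  rw [Fintype.sum_prod_type]
  simp only [tensorConn, Pi.add_apply, ite_apply, Pi.zero_apply, mul_add, mul_ite, mul_zero,
    Finset.sum_add_distrib, Finset.sum_ite_eq, Finset.sum_ite_irrel, Finset.sum_const_zero,
    Finset.mem_univ, if_true]

end

variable {κ : Type*} [Fintype κ] (M : MovingFrame R A ι)

lemma commutator_apply (i j : ι) (f : A) :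
    M.e i (M.e j f) - M.e j (M.e i f) = ∑ k, M.c i j k * M.e k f := by
  rw [← Derivation.commutator_apply, M.lie_e, derivation_sum_smul_apply]

lemma c_swap (i j k : ι) : M.c i j k = -M.c j i k := by
  refine eq_neg_of_add_eq_zero_left (M.independent (fun k => M.c i j k + M.c j i k) ?_ k)
  simp_rw [add_smul, Finset.sum_add_distrib, ← M.lie_e]
  rw [← lie_skew, neg_add_cancel]

lemma lie_lie_e (i j k : ι) :
    ⁅M.e i, ⁅M.e j, M.e k⁆⁆ =
      ∑ n, (M.e i (M.c j k n) - ∑ m, M.c j k m * M.c m i n) • M.e n := by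
  have term (m : ι) : ⁅M.e i, M.c j k m • M.e m⁆ =
      M.e i (M.c j k m) • M.e m - ∑ n, (M.c j k m * M.c m i n) • M.e n := by
    rw [LieRinehartRing.leibniz_smul_right, ← lie_skew, M.lie_e, smul_neg, Finset.smul_sum,
      neg_add_eq_sub]
    simp_rw [smul_smul]
    rfl
  rw [M.lie_e, lie_sum]
  simp_rw [term, sub_smul, Finset.sum_sub_distrib, Finset.sum_smul]
  rw [Finset.sum_comm]

/-- The exterior differential of two-forms, in components. -/
def extDeriv₂ : (ι → ι → A) →+ ι → ι → ι → A :=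
  .mk' (fun T i j k => (M.e i (T j k) - ∑ m, M.c j k m * T m i)
      + (M.e j (T k i) - ∑ m, M.c k i m * T m j) + (M.e k (T i j) - ∑ m, M.c i j m * T m k))
    fun S T => by
      ext i j k
      simp only [Pi.add_apply, map_add, mul_add, Finset.sum_add_distrib]
      ring

lemma extDeriv₂_apply (T : ι → ι → A) (i j k : ι) :
    M.extDeriv₂ T i j k = (M.e i (T j k) - ∑ m, M.c j k m * T m i)
      + (M.e j (T k i) - ∑ m, M.c k i m * T m j) + (M.e k (T i j) - ∑ m, M.c i j m * T m k) :=
  rfl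

lemma jacobi (i j k n : ι) : M.extDeriv₂ (fun r s => M.c r s n) i j k = 0 := by
  refine M.independent (fun n => M.extDeriv₂ (fun r s => M.c r s n) i j k) ?_ n
  simpa only [lie_lie_e, extDeriv₂_apply, ← Finset.sum_add_distrib, ← add_smul]
    using lie_jacobi (M.e i) (M.e j) (M.e k)

/-- The exterior differential of one-forms, in components. -/
def extDeriv : (ι → A) →+ ι → ι → A :=
  .mk' (fun φ i j => M.e i (φ j) - M.e j (φ i) - ∑ k, M.c i j k * φ k) fun φ ψ => by
    ext i j
    simp only [Pi.add_apply, map_add, mul_add, Finset.sum_add_distrib]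
    ring

lemma extDeriv_apply (φ : ι → A) (i j : ι) :
    M.extDeriv φ i j = M.e i (φ j) - M.e j (φ i) - ∑ k, M.c i j k * φ k :=
  rfl

lemma extDeriv_swap (φ : ι → A) (i j : ι) : M.extDeriv φ i j = -M.extDeriv φ j i := by
  simp only [extDeriv_apply, M.c_swap i j, neg_mul, Finset.sum_neg_distrib]
  ring

lemma extDeriv_smul (f : A) (φ : ι → A) :
    M.extDeriv (f • φ) = (M.e · f) ⋏ φ + f • M.extDeriv φ := by
  ext i j
  simp only [extDeriv_apply, wedge, Pi.add_apply, Pi.smul_apply, smul_eq_mul, Derivation.leibniz,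
    mul_sub, Finset.mul_sum, mul_left_comm f]
  ring

lemma extDeriv_e (f : A) : M.extDeriv (M.e · f) = 0 := by
  ext i j
  exact sub_eq_zero.2 (M.commutator_apply i j f)

lemma extDeriv₂_extDeriv (φ : ι → A) : M.extDeriv₂ (M.extDeriv φ) = 0 := by
  have expand (i j k : ι) : M.e i (M.extDeriv φ j k) - ∑ m, M.c j k m * M.extDeriv φ m i =
      M.e i (M.e j (φ k)) - M.e i (M.e k (φ j)) - ∑ m, M.c j k m * M.e m (φ i)
        - ∑ n, (M.e i (M.c j k n) - ∑ m, M.c j k m * M.c m i n) * φ n := by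
    have hcc : ∑ m, M.c j k m * ∑ n, M.c m i n * φ n =
        ∑ n, (∑ m, M.c j k m * M.c m i n) * φ n := by
      simp_rw [Finset.mul_sum, Finset.sum_mul]
      rw [Finset.sum_comm]
      simp_rw [mul_assoc]
    simp only [extDeriv_apply, map_sub, map_sum, Derivation.leibniz, smul_eq_mul, mul_sub, sub_mul,
      Finset.sum_sub_distrib, Finset.sum_add_distrib, hcc]
    simp_rw [mul_comm (φ _)]
    ring
  ext i j k
  have hJ : ∑ n, M.extDeriv₂ (fun r s => M.c r s n) i j k * φ n = 0 := by simp [M.jacobi]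
  simp only [extDeriv₂_apply, add_mul, Finset.sum_add_distrib] at hJ
  rw [extDeriv₂_apply, expand, expand, expand, Pi.zero_apply, Pi.zero_apply, Pi.zero_apply]
  linear_combination M.commutator_apply i j (φ k) + M.commutator_apply j k (φ i)
    + M.commutator_apply k i (φ j) - hJ

lemma extDeriv₂_wedge (φ ψ : ι → A) :
    M.extDeriv₂ (φ ⋏ ψ) = wedge₂ ψ (M.extDeriv φ) - wedge₂ φ (M.extDeriv ψ) := by
  have hc (r s t : ι) : ∑ m, M.c r s m * (φ m * ψ t - φ t * ψ m) =
      (∑ m, M.c r s m * φ m) * ψ t - φ t * ∑ m, M.c r s m * ψ m := by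
    rw [Finset.sum_mul, Finset.mul_sum, ← Finset.sum_sub_distrib]
    exact Finset.sum_congr rfl fun m _ => by ring
  ext i j k
  simp only [extDeriv₂_apply, extDeriv_apply, wedge, wedge₂, hc, map_sub, Derivation.leibniz,
    smul_eq_mul, Pi.sub_apply]
  ring

/-- The covariant differential of the tuple of functions `f` for the connection forms `Θ`. -/
def covDeriv (Θ : κ → κ → ι → A) (f : κ → A) (x : κ) (i : ι) : A :=
  M.e i (f x) - ∑ y, f y * Θ x y i

lemma e_eq_sum_add_covDeriv (Θ : κ → κ → ι → A) (f : κ → A) (x : κ) (i : ι) :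
    M.e i (f x) = ∑ y, f y * Θ x y i + M.covDeriv Θ f x i := by
  rw [covDeriv, add_sub_cancel]

/-- The curvature forms of the connection forms `Θ`. -/
def curvature (Θ : κ → κ → ι → A) (x y : κ) : ι → ι → A :=
  M.extDeriv (Θ x y) - ∑ z, Θ x z ⋏ Θ z y

lemma extDeriv_eq_sum_add_curvature (Θ : κ → κ → ι → A) (x y : κ) :
    M.extDeriv (Θ x y) = ∑ z, Θ x z ⋏ Θ z y + M.curvature Θ x y := by
  rw [curvature, add_sub_cancel]

lemma curvature_swap (Θ : κ → κ → ι → A) (x y : κ) (i j : ι) :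
    M.curvature Θ x y i j = -M.curvature Θ x y j i := by
  simp only [curvature, wedge, Pi.sub_apply, Finset.sum_apply, M.extDeriv_swap _ i j, neg_sub,
    Finset.sum_sub_distrib]
  ring

lemma extDeriv_covDeriv (Θ : κ → κ → ι → A) (f : κ → A) (x : κ) :
    M.extDeriv (M.covDeriv Θ f x) =
      ∑ y, Θ x y ⋏ M.covDeriv Θ f y - ∑ y, f y • M.curvature Θ x y := by
  have hf : M.covDeriv Θ f x = (M.e · (f x)) - ∑ y, f y • Θ x y := by
    ext i
    simp [covDeriv]
  have hΘ : ∑ y, ∑ z, f y • (Θ x z ⋏ Θ z y) = ∑ y, Θ x y ⋏ ∑ z, f z • Θ y z := by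
    rw [Finset.sum_comm]
    refine Finset.sum_congr rfl fun y _ => ?_
    ext i j
    simp only [wedge, Finset.sum_apply, Pi.smul_apply, smul_eq_mul, Finset.mul_sum,
      ← Finset.sum_sub_distrib]
    exact Finset.sum_congr rfl fun z _ => by ring
  have he (y : κ) : (M.e · (f y)) ⋏ Θ x y =
      -(Θ x y ⋏ ∑ z, f z • Θ y z) - Θ x y ⋏ M.covDeriv Θ f y := by
    ext i j
    simp only [wedge, M.e_eq_sum_add_covDeriv Θ f y, Pi.sub_apply, Pi.neg_apply, Finset.sum_apply,
      Pi.smul_apply, smul_eq_mul]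
    ring
  rw [hf, map_sub, extDeriv_e, map_sum]
  simp only [extDeriv_smul, he, extDeriv_eq_sum_add_curvature, smul_add, Finset.smul_sum,
    Finset.sum_add_distrib, Finset.sum_sub_distrib, Finset.sum_neg_distrib, hΘ]
  abel

lemma bianchi (Θ : κ → κ → ι → A) (x y : κ) :
    M.extDeriv₂ (M.curvature Θ x y) =
      ∑ z, (wedge₂ (Θ x z) (M.curvature Θ z y) - wedge₂ (Θ z y) (M.curvature Θ x z)) := by
  have hΘ : ∑ z, wedge₂ (Θ z y) (∑ v, Θ x v ⋏ Θ v z) =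
      ∑ z, wedge₂ (Θ x z) (∑ v, Θ z v ⋏ Θ v y) := by
    simp only [wedge₂_sum]
    rw [Finset.sum_comm]
    exact Finset.sum_congr rfl fun z _ => Finset.sum_congr rfl fun v _ => wedge₂_wedge _ _ _
  rw [curvature, map_sub, extDeriv₂_extDeriv, map_sum]
  simp only [extDeriv₂_wedge, extDeriv_eq_sum_add_curvature, wedge₂_add, Finset.sum_sub_distrib,
    Finset.sum_add_distrib, hΘ]
  abel

variable {ρ : Type*} [Fintype ρ] [DecidableEq κ] [DecidableEq ρ]

lemma curvature_tensorConn (Θ : κ → κ → ι → A) (Φ : ρ → ρ → ι → A) (x y : κ × ρ) :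
    M.curvature (tensorConn Θ Φ) x y =
      (if x.2 = y.2 then M.curvature Θ x.1 y.1 else 0)
        + if x.1 = y.1 then M.curvature Φ x.2 y.2 else 0 := by
  obtain ⟨x, u⟩ := x
  obtain ⟨y, v⟩ := y
  ext i j
  simp only [curvature, tensorConn, map_add, apply_ite M.extDeriv, map_zero, wedge, Pi.add_apply,
    Pi.sub_apply, Finset.sum_apply, ite_apply, Pi.zero_apply, Fintype.sum_prod_type, add_mul,
    mul_add, ite_mul, mul_ite, zero_mul, mul_zero, Finset.sum_add_distrib, Finset.sum_sub_distrib,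
    Finset.sum_ite_eq, Finset.sum_ite_eq', Finset.sum_ite_irrel, Finset.sum_const_zero,
    Finset.mem_univ, if_true]
  split_ifs <;> ring

end MovingFrame

end MovingFrames

section WebFrames

variable {R A n : Type*} [CommRing R] [CommRing A] [Algebra R A] [Fintype n] [DecidableEq n]

/-- The block diagonal extension of a matrix `w` to the two halves of the frame of a three-web; the
connection forms `w` thereby become connection forms on the tangent bundle. -/
def frameConn {E : Type*} [Zero E] (w : n → n → E) : n ⊕ n → n ⊕ n → E
  | .inl k, .inl m => w k m
  | .inr k, .inr m => w k m
  | .inl _, .inr _ => 0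
  | .inr _, .inl _ => 0

/-- The torsion of the connection of a three-web with the covector `a`. -/
def webTorsion (a : n → A) : n ⊕ n → n ⊕ n → n ⊕ n → A
  | .inl k, .inl l, .inl i => (if k = i then a l else 0) - if l = i then a k else 0
  | .inr k, .inr l, .inr i => (if l = i then a k else 0) - if k = i then a l else 0
  | .inl _, .inl _, .inr _ => 0
  | .inr _, .inr _, .inl _ => 0
  | .inl _, .inr _, _ => 0
  | .inr _, .inl _, _ => 0

/-- A moving frame adapted to a three-web: the frame vectors `inl k` and `inr k` are dual to `ω₁ᵏ`
and `ω₂ᵏ`, `w j i` are the components of the connection form `ω_jⁱ`, and `a` is the covector of the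
web. -/
structure WebFrame (R A n : Type*) [CommRing R] [CommRing A] [Algebra R A] [Fintype n]
    [DecidableEq n] extends MovingFrame R A (n ⊕ n) where
  w : n → n → n ⊕ n → A
  a : n → A
  c_eq (r s g : n ⊕ n) : c r s g = frameConn w s g r - frameConn w r g s + webTorsion a r s g

namespace WebFrame

variable {κ : Type*} [Fintype κ] [DecidableEq κ] (W : WebFrame R A n)

/-- The curvature form `dω_jⁱ - ω_jᵐ ∧ ω_mⁱ`. -/
def curv (j i : n) : n ⊕ n → n ⊕ n → A := W.curvature W.w j i

/-- The curvature tensor `bⁱ_{jkl}` of the web. -/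
def b (i j k l : n) : A := W.curv j i (.inl k) (.inr l)

/-- The covariant differential of the covector of the web; its components along the two halves of
the frame are the Pfaffian derivatives `p` and `q`. -/
def covA (i : n) (r : n ⊕ n) : A := W.covDeriv W.w W.a i r

lemma curv_swap (j i : n) (r s : n ⊕ n) : W.curv j i r s = -W.curv j i s r :=
  W.curvature_swap W.w j i r s

lemma curvature_frameConn (r s : n ⊕ n) :
    W.curvature (frameConn W.w) r s = frameConn W.curv r s := by
  rcases r with k | k <;> rcases s with l | l <;> ext <;>
    simp [MovingFrame.curvature, frameConn, MovingFrame.wedge, curv]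

lemma covDeriv_covDeriv_sub (Θ : κ → κ → n ⊕ n → A) (f : κ → A) (x : κ) (r s : n ⊕ n) :
    W.covDeriv (MovingFrame.tensorConn Θ (frameConn W.w)) (fun z => W.covDeriv Θ f z.1 z.2) (x, s) r
      - W.covDeriv (MovingFrame.tensorConn Θ (frameConn W.w)) (fun z => W.covDeriv Θ f z.1 z.2)
          (x, r) s =
      ∑ g, webTorsion W.a r s g * W.covDeriv Θ f x g - ∑ y, f y * W.curvature Θ x y r s := by
  have hcov (r s : n ⊕ n) :
      W.covDeriv (MovingFrame.tensorConn Θ (frameConn W.w)) (fun z => W.covDeriv Θ f z.1 z.2)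
        (x, s) r = W.e r (W.covDeriv Θ f x s) - ∑ y, W.covDeriv Θ f y s * Θ x y r
          - ∑ g, W.covDeriv Θ f x g * frameConn W.w s g r := by
    rw [MovingFrame.covDeriv, MovingFrame.sum_mul_tensorConn, sub_sub]
  have h := congrFun₂ (W.extDeriv_covDeriv Θ f x) r s
  simp only [MovingFrame.extDeriv_apply, W.c_eq, MovingFrame.wedge, add_mul, sub_mul, Pi.sub_apply,
    Finset.sum_apply, Pi.smul_apply, smul_eq_mul, Finset.sum_add_distrib, Finset.sum_sub_distrib]
    at h
  rw [hcov, hcov]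
  simp only [mul_comm (W.covDeriv Θ f _ _)]
  linear_combination h

/-- The second covariant differential of the covector of the web. -/
def covA₂ (i : n) (r s : n ⊕ n) : A :=
  W.covDeriv (MovingFrame.tensorConn W.w (frameConn W.w)) (fun z => W.covA z.1 z.2) (i, r) s

/-- The third covariant differential of the covector of the web. -/
def covA₃ (i : n) (r s t : n ⊕ n) : A :=
  W.covDeriv (MovingFrame.tensorConn (MovingFrame.tensorConn W.w (frameConn W.w)) (frameConn W.w))
    (fun z => W.covA₂ z.1.1 z.1.2 z.2) ((i, r), s) t

lemma e_a (i : n) (t : n ⊕ n) : W.e t (W.a i) = ∑ m, W.a m * W.w i m t + W.covA i t :=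
  W.e_eq_sum_add_covDeriv W.w W.a i t

lemma e_covA (i : n) (r t : n ⊕ n) : W.e t (W.covA i r) =
    ∑ m, W.covA m r * W.w i m t + ∑ g, W.covA i g * frameConn W.w r g t + W.covA₂ i r t := by
  rw [covA₂, MovingFrame.covDeriv, MovingFrame.sum_mul_tensorConn, add_sub_cancel]

lemma e_covA₂ (i : n) (r s t : n ⊕ n) : W.e t (W.covA₂ i r s) =
    ∑ m, W.covA₂ m r s * W.w i m t + ∑ g, W.covA₂ i g s * frameConn W.w r g t
      + ∑ g, W.covA₂ i r g * frameConn W.w s g t + W.covA₃ i r s t := by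
  rw [covA₃, MovingFrame.covDeriv, MovingFrame.sum_mul_tensorConn, MovingFrame.sum_mul_tensorConn,
    add_sub_cancel]

lemma covA₂_sub_covA₂ (i : n) (r s : n ⊕ n) :
    W.covA₂ i s r - W.covA₂ i r s =
      ∑ g, webTorsion W.a r s g * W.covA i g - ∑ m, W.a m * W.curv i m r s :=
  W.covDeriv_covDeriv_sub W.w W.a i r s

lemma covA₃_sub_covA₃ (i : n) (r s t : n ⊕ n) :
    W.covA₃ i r t s - W.covA₃ i r s t =
      ∑ g, webTorsion W.a s t g * W.covA₂ i r g - ∑ m, W.covA m r * W.curv i m s t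
        - ∑ g, W.covA i g * frameConn W.curv r g s t := by
  have h := W.covDeriv_covDeriv_sub (MovingFrame.tensorConn W.w (frameConn W.w))
    (fun z => W.covA z.1 z.2) (i, r) s t
  simp only [MovingFrame.curvature_tensorConn, curvature_frameConn] at h
  simp only [Fintype.sum_prod_type, Pi.add_apply, ite_apply, Pi.zero_apply, mul_add, mul_ite,
    mul_zero, Finset.sum_add_distrib, Finset.sum_ite_eq, Finset.sum_ite_irrel,
    Finset.sum_const_zero, Finset.mem_univ, if_true, ← sub_sub] at h
  exact h

lemma curv_inl_inl (j i k l : n) : W.curv j i (.inl k) (.inl l) = 0 := by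
  have h := W.jacobi (.inl k) (.inl l) (.inr j) (.inr i)
  simp only [MovingFrame.extDeriv₂_apply, W.c_eq, frameConn, webTorsion, Pi.zero_apply, sub_zero,
    zero_sub, add_zero, Fintype.sum_sum_type, add_mul, sub_mul, mul_add, mul_sub, ite_mul, mul_ite,
    mul_neg, mul_zero, zero_mul, ite_self, map_neg, map_zero, Finset.sum_add_distrib,
    Finset.sum_sub_distrib, Finset.sum_neg_distrib, Finset.sum_ite_eq, Finset.sum_const_zero,
    Finset.mem_univ, if_true] at h
  simp only [curv, MovingFrame.curvature, MovingFrame.extDeriv_apply, MovingFrame.wedge, W.c_eq,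
    frameConn, webTorsion, Pi.zero_apply, add_zero, Fintype.sum_sum_type, Pi.sub_apply,
    Finset.sum_apply, add_mul, sub_mul, ite_mul, zero_mul, Finset.sum_add_distrib,
    Finset.sum_sub_distrib, Finset.sum_ite_eq, Finset.sum_const_zero, Finset.mem_univ, if_true]
  linear_combination h

lemma curv_inr_inr (j i k l : n) : W.curv j i (.inr k) (.inr l) = 0 := by
  have h := W.jacobi (.inr k) (.inr l) (.inl j) (.inl i)
  simp only [MovingFrame.extDeriv₂_apply, W.c_eq, frameConn, webTorsion, Pi.zero_apply, sub_zero,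
    zero_sub, add_zero, Fintype.sum_sum_type, add_mul, sub_mul, mul_add, mul_sub, ite_mul, mul_ite,
    mul_neg, mul_zero, zero_mul, ite_self, map_neg, map_zero, Finset.sum_add_distrib,
    Finset.sum_sub_distrib, Finset.sum_neg_distrib, Finset.sum_ite_eq, Finset.sum_const_zero,
    Finset.mem_univ, if_true] at h
  simp only [curv, MovingFrame.curvature, MovingFrame.extDeriv_apply, MovingFrame.wedge, W.c_eq,
    frameConn, webTorsion, Pi.zero_apply, Fintype.sum_sum_type, Pi.sub_apply, Finset.sum_apply,
    add_mul, sub_mul, ite_mul, zero_mul, Finset.sum_add_distrib, Finset.sum_sub_distrib,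
    Finset.sum_ite_eq, Finset.sum_const_zero, Finset.mem_univ, if_true]
  linear_combination h

lemma b_sub_b_eq_covA_inr (i k l m : n) :
    W.b i k l m - W.b i l k m =
      (if l = i then W.covA k (.inr m) else 0) - (if k = i then W.covA l (.inr m) else 0) := by
  have h := W.jacobi (.inl k) (.inl l) (.inr m) (.inl i)
  simp only [MovingFrame.extDeriv₂_apply, W.c_eq, frameConn, webTorsion, Pi.zero_apply, sub_zero,
    zero_sub, add_zero, Fintype.sum_sum_type, add_mul, sub_mul, mul_add, mul_sub, ite_mul, mul_ite,
    mul_neg, mul_zero, zero_mul, map_add, map_sub, map_neg, map_zero, apply_ite (W.e _),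
    Finset.sum_add_distrib, Finset.sum_sub_distrib, Finset.sum_neg_distrib, Finset.sum_ite_eq,
    Finset.sum_ite_eq', Finset.sum_ite_irrel, Finset.sum_const_zero, Finset.mem_univ, if_true] at h
  simp only [b, covA, MovingFrame.covDeriv, mul_comm (W.a _), curv, MovingFrame.curvature,
    MovingFrame.extDeriv_apply, MovingFrame.wedge, W.c_eq, frameConn, webTorsion, Pi.zero_apply,
    sub_zero, zero_sub, add_zero, Fintype.sum_sum_type, Pi.sub_apply, Finset.sum_apply, neg_mul,
    Finset.sum_sub_distrib, Finset.sum_neg_distrib]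
  split_ifs at h ⊢ <;> linear_combination h

lemma b_sub_b_eq_covA_inl (i k l m : n) :
    W.b i k m l - W.b i l m k =
      (if l = i then W.covA k (.inl m) else 0) - (if k = i then W.covA l (.inl m) else 0) := by
  have h := W.jacobi (.inr k) (.inr l) (.inl m) (.inr i)
  simp only [MovingFrame.extDeriv₂_apply, W.c_eq, frameConn, webTorsion, Pi.zero_apply, sub_zero,
    zero_sub, add_zero, Fintype.sum_sum_type, add_mul, sub_mul, mul_add, mul_sub, ite_mul, mul_ite,
    mul_neg, mul_zero, zero_mul, map_add, map_sub, map_neg, map_zero, apply_ite (W.e _),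
    Finset.sum_add_distrib, Finset.sum_sub_distrib, Finset.sum_neg_distrib, Finset.sum_ite_eq,
    Finset.sum_ite_eq', Finset.sum_ite_irrel, Finset.sum_const_zero, Finset.mem_univ, if_true] at h
  simp only [b, covA, MovingFrame.covDeriv, mul_comm (W.a _), curv, MovingFrame.curvature,
    MovingFrame.extDeriv_apply, MovingFrame.wedge, W.c_eq, frameConn, webTorsion, Pi.zero_apply,
    sub_zero, zero_sub, add_zero, Fintype.sum_sum_type, Pi.sub_apply, Finset.sum_apply, neg_mul,
    Finset.sum_sub_distrib, Finset.sum_neg_distrib]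
  split_ifs at h ⊢ <;> linear_combination -h

end WebFrame

end WebFrames

section SpecialWebs

local notation "X₁" => (Sum.inl (0 : Fin 2) : Fin 2 ⊕ Fin 2)
local notation "X₂" => (Sum.inl (1 : Fin 2) : Fin 2 ⊕ Fin 2)
local notation "Y₁" => (Sum.inr (0 : Fin 2) : Fin 2 ⊕ Fin 2)
local notation "Y₂" => (Sum.inr (1 : Fin 2) : Fin 2 ⊕ Fin 2)

lemma eq_zero_of_ofNat_mul {A : Type*} [CommRing A] [IsAddTorsionFree A] (n : ℕ)
    [n.AtLeastTwo] {x : A} (h : ofNat(n) * x = 0) : x = 0 := by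
  rw [← Nat.cast_ofNat, ← nsmul_eq_mul] at h
  exact (nsmul_eq_zero_iff_right (NeZero.ne _)).1 h

lemma eq_zero_of_mul_quadratic {A : Type*} [CommRing A] [IsAddTorsionFree A] {x p q : A}
    (hu : IsUnit (p ^ 2 + q ^ 2)) (hp : x * p ^ 2 = 2 * (x * (p * q)))
    (hq : x * q ^ 2 = 2 * (x * (p * q))) : x = 0 := by
  have h : x * (p ^ 2 * q) = 0 := by
    refine eq_zero_of_ofNat_mul 3 ?_
    linear_combination -q * hp - 2 * p * hq
  refine (hu.pow 2).mul_left_eq_zero.1 ?_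
  linear_combination p ^ 2 * hp + q ^ 2 * hq + 2 * (p + 3 * q) * h + 2 * p * q * hq

namespace WebFrame

variable {R A n : Type*} [CommRing R] [CommRing A] [Algebra R A]

section

variable [Fintype n] [DecidableEq n] (W : WebFrame R A n)

lemma curv_inr_inl (j i k l : n) : W.curv j i (.inr l) (.inl k) = -W.b i j k l :=
  W.curv_swap _ _ _ _

lemma curv_eq_zero {j i : n} (h : ∀ k l, W.b i j k l = 0) : W.curv j i = 0 := by
  ext (r | r) (s | s)
  · exact W.curv_inl_inl ..
  · exact h r s
  · rw [curv_inr_inl, h, neg_zero]; rfl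
  · exact W.curv_inr_inr ..

lemma extDeriv_covA (i : n) : W.extDeriv (W.covA i) =
    ∑ m, W.w i m ⋏ W.covA m - ∑ m, W.a m • W.curv i m :=
  W.extDeriv_covDeriv W.w W.a i

lemma extDeriv₂_curv (j i : n) : W.extDeriv₂ (W.curv j i) = ∑ m,
    (MovingFrame.wedge₂ (W.w j m) (W.curv m i) - MovingFrame.wedge₂ (W.w m i) (W.curv j m)) :=
  W.bianchi W.w j i

lemma curv_inl_inr (j i k l : n) : W.curv j i (.inl k) (.inr l) = W.b i j k l :=
  rfl

end

variable {W : WebFrame R A (Fin 2)}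

/-- The curvature conditions that a transversally geodesic web with `b¹ = 0` satisfies. -/
structure IsSpecial (W : WebFrame R A (Fin 2)) : Prop where
  b_zero (j k l : Fin 2) : W.b 0 j k l = 0
  b_one_zero : W.b 1 0 0 0 = 0
  b_one_one : W.b 1 1 1 1 = 0
  b_sum_zero : W.b 1 0 0 1 + W.b 1 0 1 0 + W.b 1 1 0 0 = 0
  b_sum_one : W.b 1 0 1 1 + W.b 1 1 0 1 + W.b 1 1 1 0 = 0

namespace IsSpecial

variable (hW : W.IsSpecial)
include hW

lemma curv_zero (j : Fin 2) : W.curv j 0 = 0 :=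
  W.curv_eq_zero fun k l => hW.b_zero j k l

lemma covA_one : W.covA 1 = 0 := by
  ext (m | m)
  · simpa [hW.b_zero] using W.b_sub_b_eq_covA_inl 0 0 1 m
  · simpa [hW.b_zero] using W.b_sub_b_eq_covA_inr 0 0 1 m

lemma wedge₂_curv : MovingFrame.wedge₂ (W.w 1 0) (W.curv 1 1) = 0 := by
  have h := W.extDeriv₂_curv 1 0
  simpa [hW.curv_zero, Fin.sum_univ_two] using h

lemma wedge_covA : W.w 1 0 ⋏ W.covA 0 = W.a 1 • W.curv 1 1 := by
  have h := W.extDeriv_covA 1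
  simpa [hW.curv_zero, hW.covA_one, Fin.sum_univ_two, sub_eq_zero] using h.symm

lemma three_mul_b_zero :
    3 * W.b 1 1 0 0 = -(W.covA 0 X₁ + W.covA 0 Y₁) ∧
    3 * W.b 1 0 0 1 = 2 * W.covA 0 X₁ - W.covA 0 Y₁ ∧
    3 * W.b 1 0 1 0 = 2 * W.covA 0 Y₁ - W.covA 0 X₁ := by
  have p : W.b 1 0 0 1 - W.b 1 1 0 0 = W.covA 0 X₁ := by
    simpa using W.b_sub_b_eq_covA_inl 1 0 1 0
  have q : W.b 1 0 1 0 - W.b 1 1 0 0 = W.covA 0 Y₁ := by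
    simpa using W.b_sub_b_eq_covA_inr 1 0 1 0
  have s := hW.b_sum_zero
  refine ⟨?_, ?_, ?_⟩
  · linear_combination s - p - q
  · linear_combination s + 2 * p - q
  · linear_combination s - p + 2 * q

lemma three_mul_b_one :
    3 * W.b 1 0 1 1 = W.covA 0 X₂ + W.covA 0 Y₂ ∧
    3 * W.b 1 1 1 0 = W.covA 0 Y₂ - 2 * W.covA 0 X₂ ∧
    3 * W.b 1 1 0 1 = W.covA 0 X₂ - 2 * W.covA 0 Y₂ := by
  have p : W.b 1 0 1 1 - W.b 1 1 1 0 = W.covA 0 X₂ := by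
    simpa using W.b_sub_b_eq_covA_inl 1 0 1 1
  have q : W.b 1 0 1 1 - W.b 1 1 0 1 = W.covA 0 Y₂ := by
    simpa using W.b_sub_b_eq_covA_inr 1 0 1 1
  have s := hW.b_sum_one
  refine ⟨?_, ?_, ?_⟩
  · linear_combination s + p + q
  · linear_combination s - 2 * p + q
  · linear_combination s + p - 2 * q

variable [IsAddTorsionFree A]

lemma w_X₂_and_w_Y₂_eq_zero (hu : IsUnit (W.covA 0 X₂ ^ 2 + W.covA 0 Y₂ ^ 2)) :
    W.w 1 0 X₂ = 0 ∧ W.w 1 0 Y₂ = 0 := by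
  obtain ⟨-, b₁₀, b₀₁⟩ := hW.three_mul_b_one
  have hX := congrFun₂ (congrFun hW.wedge₂_curv X₁) X₂ Y₂
  have hY := congrFun₂ (congrFun hW.wedge₂_curv X₂) Y₁ Y₂
  have hXY := congrFun₂ hW.wedge_covA X₂ Y₂
  simp only [MovingFrame.wedge₂, MovingFrame.wedge, Pi.zero_apply, Pi.smul_apply, smul_eq_mul,
    curv_inl_inl, curv_inr_inr, curv_inl_inr, curv_inr_inl, hW.b_one_one, mul_zero, add_zero,
    zero_add, neg_zero] at hX hY hXY
  have hX₂ : W.w 1 0 X₂ = 0 := by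
    apply eq_zero_of_mul_quadratic hu
    · linear_combination -3 * W.covA 0 X₂ * hX - W.covA 0 X₂ * W.w 1 0 X₂ * b₀₁
    · linear_combination -(2 * W.covA 0 X₂ - W.covA 0 Y₂) * hXY + 3 * W.covA 0 X₂ * hY
        - W.covA 0 X₂ * W.w 1 0 Y₂ * b₁₀
  refine ⟨hX₂, eq_zero_of_mul_quadratic hu ?_ ?_⟩
  · linear_combination -(W.covA 0 X₂ - 2 * W.covA 0 Y₂) * hXY
      + W.covA 0 Y₂ * (W.covA 0 X₂ - 2 * W.covA 0 Y₂) * hX₂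
  · linear_combination 3 * W.covA 0 Y₂ * hY - W.covA 0 Y₂ * W.w 1 0 Y₂ * b₁₀

lemma w_and_a_eq_zero (hu : IsUnit (W.covA 0 X₂ ^ 2 + W.covA 0 Y₂ ^ 2)) :
    W.w 1 0 = 0 ∧ W.a 1 = 0 := by
  obtain ⟨hX₂, hY₂⟩ := hW.w_X₂_and_w_Y₂_eq_zero hu
  obtain ⟨-, b₁₀, b₀₁⟩ := hW.three_mul_b_one
  have hXX := congrFun₂ hW.wedge_covA X₁ X₂
  have hYY := congrFun₂ hW.wedge_covA Y₁ Y₂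
  have hXY := congrFun₂ hW.wedge_covA X₁ Y₂
  have hYX := congrFun₂ hW.wedge_covA X₂ Y₁
  simp only [MovingFrame.wedge, Pi.smul_apply, smul_eq_mul, curv_inl_inl, curv_inr_inr,
    curv_inl_inr, mul_zero, zero_mul, sub_zero, zero_sub, hX₂, hY₂] at hXX hYY hXY hYX
  have ha : W.a 1 = 0 := by
    apply eq_zero_of_mul_quadratic hu
    · linear_combination -3 * W.covA 0 X₂ * hXY + 3 * W.covA 0 Y₂ * hXX
        - W.a 1 * W.covA 0 X₂ * b₀₁
    · linear_combination -3 * W.covA 0 Y₂ * hYX - 3 * W.covA 0 X₂ * hYY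
        - W.a 1 * W.covA 0 Y₂ * b₁₀
  rw [ha, zero_mul] at hXY hYX
  have hX₁ : W.w 1 0 X₁ = 0 := hu.mul_left_eq_zero.1 <| by
    linear_combination W.covA 0 X₂ * hXX + W.covA 0 Y₂ * hXY
  have hY₁ : W.w 1 0 Y₁ = 0 := hu.mul_left_eq_zero.1 <| by
    linear_combination -W.covA 0 X₂ * hYX + W.covA 0 Y₂ * hYY
  refine ⟨?_, ha⟩
  ext (r | r) <;> fin_cases r <;> assumption

end IsSpecial

end WebFrame

lemma derivation_ofNat_eq_zero {R A : Type*} [CommRing R] [CommRing A] [Algebra R A]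
    (D : Derivation R A A) (n : ℕ) [n.AtLeastTwo] : D ofNat(n) = 0 :=
  D.map_natCast n

namespace WebFrame

variable {R A : Type*} [CommRing R] [CommRing A] [Algebra R A] {W : WebFrame R A (Fin 2)}

/-- The frames to which a special web reduces where it is nonisoclinic. -/
structure IsReduced (W : WebFrame R A (Fin 2)) : Prop extends W.IsSpecial where
  w_eq_zero : W.w 1 0 = 0
  a_eq_zero : W.a 1 = 0

namespace IsReduced

variable (hW : W.IsReduced)

local notation "γ" => W.w 0 0
local notation "α" => W.w 0 1
local notation "β" => W.w 1 1
local notation "a₁" => W.a 0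
local notation "p₁" => W.covA 0 X₁
local notation "p₂" => W.covA 0 X₂
local notation "q₁" => W.covA 0 Y₁
local notation "q₂" => W.covA 0 Y₂
local notation "S" => W.covA₂ 0 X₁ Y₁
local notation "G" => W.covA₂ 0 X₁ Y₂
local notation "F" => W.covA₂ 0 X₂ Y₁
local notation "B" => W.covA₂ 0 X₂ Y₂

include hW

lemma e_a₁ (t : Fin 2 ⊕ Fin 2) : W.e t a₁ = a₁ * γ t + W.covA 0 t := by
  simp [W.e_a, hW.a_eq_zero]

lemma e_p₁ (t : Fin 2 ⊕ Fin 2) : W.e t p₁ = 2 * p₁ * γ t + p₂ * α t + W.covA₂ 0 X₁ t := by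
  simp only [W.e_covA, Fin.sum_univ_two, hW.covA_one, Pi.zero_apply, zero_mul, add_zero, frameConn,
    Fintype.sum_sum_type, mul_zero, Finset.sum_const_zero, add_left_inj]
  ring

lemma e_p₂ (t : Fin 2 ⊕ Fin 2) : W.e t p₂ = p₂ * (γ t + β t) + W.covA₂ 0 X₂ t := by
  simp only [W.e_covA, Fin.sum_univ_two, hW.covA_one, Pi.zero_apply, zero_mul, add_zero, frameConn,
    Fintype.sum_sum_type, hW.w_eq_zero, mul_zero, zero_add, Finset.sum_const_zero, add_left_inj]
  ring

lemma e_q₁ (t : Fin 2 ⊕ Fin 2) : W.e t q₁ = 2 * q₁ * γ t + q₂ * α t + W.covA₂ 0 Y₁ t := by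
  simp only [W.e_covA, Fin.sum_univ_two, hW.covA_one, Pi.zero_apply, zero_mul, add_zero, frameConn,
    Fintype.sum_sum_type, mul_zero, Finset.sum_const_zero, zero_add, add_left_inj]
  ring

lemma e_q₂ (t : Fin 2 ⊕ Fin 2) : W.e t q₂ = q₂ * (γ t + β t) + W.covA₂ 0 Y₂ t := by
  simp only [W.e_covA, Fin.sum_univ_two, hW.covA_one, Pi.zero_apply, zero_mul, add_zero, frameConn,
    Fintype.sum_sum_type, mul_zero, Finset.sum_const_zero, hW.w_eq_zero, zero_add, add_left_inj]
  ring

lemma covA₂_one : W.covA₂ 1 = 0 := by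
  ext r s
  have h := W.e_covA 1 r s
  simpa [hW.covA_one, hW.w_eq_zero] using h.symm

lemma covA₂_swap (k l : Fin 2) : W.covA₂ 0 (.inr l) (.inl k) = W.covA₂ 0 (.inl k) (.inr l) := by
  have h := W.covA₂_sub_covA₂ 0 (.inl k) (.inr l)
  simpa [webTorsion, hW.curv_zero, hW.a_eq_zero, sub_eq_zero] using h

lemma covA₂_X₁_X₂_sub : W.covA₂ 0 X₁ X₂ = W.covA₂ 0 X₂ X₁ + a₁ * p₂ := by
  have h := W.covA₂_sub_covA₂ 0 X₂ X₁
  simp only [webTorsion, Fintype.sum_sum_type, hW.a_eq_zero, ite_self, sub_zero, ite_mul, zero_mul,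
    Finset.sum_ite_eq, Finset.mem_univ, ↓reduceIte, Finset.sum_const_zero, add_zero, W.curv_inl_inl,
    mul_zero] at h
  linear_combination h

lemma covA₂_Y₁_Y₂_sub : W.covA₂ 0 Y₁ Y₂ = W.covA₂ 0 Y₂ Y₁ - a₁ * q₂ := by
  have h := W.covA₂_sub_covA₂ 0 Y₂ Y₁
  simp only [webTorsion, Fintype.sum_sum_type, zero_mul, Finset.sum_const_zero, hW.a_eq_zero,
    ite_self, zero_sub, neg_mul, ite_mul, Finset.sum_neg_distrib, Finset.sum_ite_eq,
    Finset.mem_univ, ↓reduceIte, zero_add, W.curv_inr_inr, mul_zero, sub_zero] at h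
  linear_combination h

lemma extDeriv₂_curv_one_one : W.extDeriv₂ (W.curv 1 1) = 0 := by
  simp [W.extDeriv₂_curv, hW.w_eq_zero, hW.curv_zero]

lemma extDeriv₂_curv_zero_one : W.extDeriv₂ (W.curv 0 1) =
    MovingFrame.wedge₂ γ (W.curv 0 1) - MovingFrame.wedge₂ β (W.curv 0 1)
      + MovingFrame.wedge₂ α (W.curv 1 1) := by
  simp only [W.extDeriv₂_curv, hW.curv_zero, Fin.sum_univ_two, MovingFrame.wedge₂_zero]
  abel

lemma e_b_zero (t : Fin 2 ⊕ Fin 2) :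
    3 * W.e t (W.b 1 1 0 0) = 6 * W.b 1 1 0 0 * γ t - 3 * W.b 1 0 1 1 * α t - W.covA₂ 0 X₁ t
      - W.covA₂ 0 Y₁ t ∧
    3 * W.e t (W.b 1 0 0 1) = 6 * W.b 1 0 0 1 * γ t - 3 * W.b 1 1 1 0 * α t + 2 * W.covA₂ 0 X₁ t
      - W.covA₂ 0 Y₁ t ∧
    3 * W.e t (W.b 1 0 1 0) = 6 * W.b 1 0 1 0 * γ t - 3 * W.b 1 1 0 1 * α t + 2 * W.covA₂ 0 Y₁ t
      - W.covA₂ 0 X₁ t := by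
  obtain ⟨h₁, h₂, h₃⟩ := hW.three_mul_b_zero
  obtain ⟨k₁, k₂, k₃⟩ := hW.three_mul_b_one
  have d₁ := congrArg (W.e t) h₁
  have d₂ := congrArg (W.e t) h₂
  have d₃ := congrArg (W.e t) h₃
  simp only [Derivation.leibniz, smul_eq_mul, derivation_ofNat_eq_zero, mul_zero, add_zero,
    neg_add_rev, map_add, map_neg, hW.e_q₁, hW.e_p₁, map_sub] at d₁ d₂ d₃
  refine ⟨?_, ?_, ?_⟩
  · linear_combination d₁ - 2 * γ t * h₁ + α t * k₁
  · linear_combination d₂ - 2 * γ t * h₂ + α t * k₂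
  · linear_combination d₃ - 2 * γ t * h₃ + α t * k₃

lemma e_b_one (t : Fin 2 ⊕ Fin 2) :
    3 * W.e t (W.b 1 0 1 1) = 3 * W.b 1 0 1 1 * (γ t + β t) + W.covA₂ 0 X₂ t + W.covA₂ 0 Y₂ t ∧
    3 * W.e t (W.b 1 1 1 0) = 3 * W.b 1 1 1 0 * (γ t + β t) + W.covA₂ 0 Y₂ t - 2 * W.covA₂ 0 X₂ t ∧
    3 * W.e t (W.b 1 1 0 1) = 3 * W.b 1 1 0 1 * (γ t + β t) + W.covA₂ 0 X₂ t
      - 2 * W.covA₂ 0 Y₂ t := by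
  obtain ⟨h₁, h₂, h₃⟩ := hW.three_mul_b_one
  have d₁ := congrArg (W.e t) h₁
  have d₂ := congrArg (W.e t) h₂
  have d₃ := congrArg (W.e t) h₃
  simp only [Derivation.leibniz, smul_eq_mul, derivation_ofNat_eq_zero, mul_zero, add_zero, map_add,
    hW.e_p₂, hW.e_q₂, map_sub] at d₁ d₂ d₃
  refine ⟨?_, ?_, ?_⟩
  · linear_combination d₁ - (γ t + β t) * h₁
  · linear_combination d₂ - (γ t + β t) * h₂
  · linear_combination d₃ - (γ t + β t) * h₃

lemma covA₂_X₂_X₂ : W.covA₂ 0 X₂ X₂ = 2 * B := by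
  have h := congrFun₂ (congrFun hW.extDeriv₂_curv_one_one X₁) X₂ Y₂
  simp only [MovingFrame.extDeriv₂_apply, curv_inl_inr, hW.b_one_one, map_zero, W.c_eq, frameConn,
    webTorsion, add_zero, Fintype.sum_sum_type, Pi.zero_apply, zero_sub, curv_inl_inl, mul_zero,
    Finset.sum_const_zero, sub_zero, curv_inr_inl, mul_neg, Finset.sum_neg_distrib,
    Fin.sum_univ_two, hW.w_eq_zero, zero_mul, zero_add, sub_neg_eq_add, map_neg, neg_mul, neg_neg,
    hW.a_eq_zero, ite_self, one_ne_zero, ↓reduceIte, neg_zero, sub_self, curv_inr_inr] at h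
  linear_combination -3 * h - (hW.e_b_one X₂).2.2 + 2 * hW.covA₂_swap 1 1

lemma covA₂_Y₂_Y₂ : W.covA₂ 0 Y₂ Y₂ = 2 * B := by
  have h := congrFun₂ (congrFun hW.extDeriv₂_curv_one_one X₂) Y₁ Y₂
  simp only [MovingFrame.extDeriv₂_apply, curv_inr_inr, map_zero, W.c_eq, frameConn, webTorsion,
    Fintype.sum_sum_type, Pi.zero_apply, sub_self, add_zero, curv_inl_inl, mul_zero,
    Finset.sum_const_zero, hW.a_eq_zero, ite_self, sub_zero, curv_inr_inl, mul_neg,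
    Finset.sum_neg_distrib, Fin.sum_univ_two, hW.w_eq_zero, zero_sub, one_ne_zero, ↓reduceIte,
    neg_mul, hW.b_one_one, neg_neg, zero_add, neg_zero, curv_inl_inr, zero_mul] at h
  linear_combination 3 * h - (hW.e_b_one Y₂).2.1

lemma covA₂_X₂_X₁ : W.covA₂ 0 X₂ X₁ = F + G + a₁ * (q₂ - p₂) := by
  have h := congrFun₂ (congrFun hW.extDeriv₂_curv_one_one X₁) X₂ Y₁
  simp only [MovingFrame.extDeriv₂_apply, curv_inl_inr, W.c_eq, frameConn, webTorsion, add_zero,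
    Fintype.sum_sum_type, Pi.zero_apply, zero_sub, curv_inl_inl, mul_zero, Finset.sum_const_zero,
    sub_zero, curv_inr_inl, mul_neg, Finset.sum_neg_distrib, Fin.sum_univ_two, neg_add_rev,
    zero_add, map_neg, neg_mul, neg_neg, hW.b_one_one, map_zero, hW.a_eq_zero, ite_self,
    hW.w_eq_zero, one_ne_zero, ↓reduceIte, neg_zero, sub_self, curv_inr_inr] at h
  obtain ⟨c₁, c₂, c₃⟩ := hW.three_mul_b_one
  linear_combination -3 * h + (hW.e_b_one X₁).2.1 - (hW.e_b_zero X₂).1 + a₁ * c₂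
    + hW.covA₂_X₁_X₂_sub + α X₂ * (c₁ + c₂ + c₃) + hW.covA₂_swap 0 1 + hW.covA₂_swap 1 0

lemma covA₂_Y₂_Y₁ : W.covA₂ 0 Y₂ Y₁ = F + G + a₁ * (q₂ - p₂) := by
  have h := congrFun₂ (congrFun hW.extDeriv₂_curv_one_one X₁) Y₁ Y₂
  simp only [MovingFrame.extDeriv₂_apply, curv_inr_inr, map_zero, W.c_eq, frameConn, webTorsion,
    Fintype.sum_sum_type, Pi.zero_apply, sub_self, add_zero, curv_inl_inl, mul_zero,
    Finset.sum_const_zero, hW.a_eq_zero, ite_self, sub_zero, curv_inr_inl, mul_neg,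
    Finset.sum_neg_distrib, Fin.sum_univ_two, hW.w_eq_zero, zero_sub, one_ne_zero, ↓reduceIte,
    neg_mul, neg_add_rev, neg_neg, zero_add, map_neg, curv_inl_inr, hW.b_one_one, sub_neg_eq_add]
      at h
  obtain ⟨c₁, c₂, c₃⟩ := hW.three_mul_b_one
  linear_combination 3 * h + (hW.e_b_one Y₁).2.2 - (hW.e_b_zero Y₂).1 - a₁ * c₃
    + hW.covA₂_Y₁_Y₂_sub + α Y₂ * (c₁ + c₂ + c₃)

lemma covA₂_X₁_X₁ : W.covA₂ 0 X₁ X₁ = 2 * S + a₁ * (2 * q₁ - p₁) := by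
  have h := congrFun₂ (congrFun hW.extDeriv₂_curv_zero_one X₁) X₂ Y₁
  simp only [MovingFrame.extDeriv₂_apply, curv_inl_inr, W.c_eq, frameConn, webTorsion, add_zero,
    Fintype.sum_sum_type, Pi.zero_apply, zero_sub, curv_inl_inl, mul_zero, Finset.sum_const_zero,
    sub_zero, curv_inr_inl, mul_neg, Finset.sum_neg_distrib, Fin.sum_univ_two, hW.b_one_zero,
    zero_add, sub_neg_eq_add, neg_zero, map_zero, neg_mul, neg_neg, neg_add_rev, hW.a_eq_zero,
    ite_self, hW.w_eq_zero, one_ne_zero, ↓reduceIte, sub_self, curv_inr_inr, Pi.add_apply,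
    Pi.sub_apply, MovingFrame.wedge₂] at h
  obtain ⟨b₁, b₂, b₃⟩ := hW.three_mul_b_zero
  obtain ⟨c₁, c₂, c₃⟩ := hW.three_mul_b_one
  linear_combination -3 * h + (hW.e_b_zero X₁).2.2 + a₁ * b₃ + 2 * hW.covA₂_swap 0 0
    + α X₂ * (b₁ + b₂ + b₃) - α X₁ * (c₁ + c₂ + c₃)

lemma covA₂_Y₁_Y₁ : W.covA₂ 0 Y₁ Y₁ = 2 * S - a₁ * (2 * p₁ - q₁) := by
  have h := congrFun₂ (congrFun hW.extDeriv₂_curv_zero_one X₁) Y₁ Y₂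
  simp only [MovingFrame.extDeriv₂_apply, curv_inr_inr, map_zero, W.c_eq, frameConn, webTorsion,
    Fintype.sum_sum_type, Pi.zero_apply, sub_self, add_zero, curv_inl_inl, mul_zero,
    Finset.sum_const_zero, hW.a_eq_zero, ite_self, sub_zero, curv_inr_inl, mul_neg,
    Finset.sum_neg_distrib, Fin.sum_univ_two, hW.w_eq_zero, zero_sub, one_ne_zero, ↓reduceIte,
    hW.b_one_zero, zero_add, sub_neg_eq_add, map_neg, curv_inl_inr, neg_mul, neg_add_rev, neg_neg,
    Pi.add_apply, Pi.sub_apply, MovingFrame.wedge₂] at h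
  obtain ⟨b₁, b₂, b₃⟩ := hW.three_mul_b_zero
  obtain ⟨c₁, c₂, c₃⟩ := hW.three_mul_b_one
  linear_combination 3 * h + (hW.e_b_zero Y₁).2.1 - a₁ * b₂
    + α Y₂ * (b₁ + b₂ + b₃) - α Y₁ * (c₁ + c₂ + c₃)

lemma covA₂_X₁_X₂ : W.covA₂ 0 X₁ X₂ = F + G + a₁ * q₂ := by
  linear_combination hW.covA₂_X₁_X₂_sub + hW.covA₂_X₂_X₁

lemma covA₂_Y₁_Y₂ : W.covA₂ 0 Y₁ Y₂ = F + G - a₁ * p₂ := by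
  linear_combination hW.covA₂_Y₁_Y₂_sub + hW.covA₂_Y₂_Y₁

local notation "δS" => W.covA₃ 0 X₁ Y₁
local notation "δG" => W.covA₃ 0 X₁ Y₂
local notation "δF" => W.covA₃ 0 X₂ Y₁
local notation "δB" => W.covA₃ 0 X₂ Y₂

lemma e_G (t : Fin 2 ⊕ Fin 2) : W.e t G = G * (2 * γ t + β t) + B * α t + δG t := by
  simp only [W.e_covA₂, Fin.sum_univ_two, hW.covA₂_one, Pi.zero_apply, zero_mul, add_zero,
    frameConn, Fintype.sum_sum_type, mul_zero, Finset.sum_const_zero, hW.w_eq_zero, zero_add,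
    add_left_inj]
  ring

lemma e_F (t : Fin 2 ⊕ Fin 2) : W.e t F = F * (2 * γ t + β t) + B * α t + δF t := by
  simp only [W.e_covA₂, Fin.sum_univ_two, hW.covA₂_one, Pi.zero_apply, zero_mul, add_zero,
    frameConn, Fintype.sum_sum_type, hW.w_eq_zero, mul_zero, zero_add, Finset.sum_const_zero,
    add_left_inj]
  ring

lemma e_B (t : Fin 2 ⊕ Fin 2) : W.e t B = B * (γ t + 2 * β t) + δB t := by
  simp only [W.e_covA₂, Fin.sum_univ_two, hW.covA₂_one, Pi.zero_apply, zero_mul, add_zero,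
    frameConn, Fintype.sum_sum_type, hW.w_eq_zero, mul_zero, zero_add, Finset.sum_const_zero,
    add_left_inj]
  ring

lemma covA₃_swap (k l : Fin 2) (t : Fin 2 ⊕ Fin 2) :
    W.covA₃ 0 (.inr l) (.inl k) t = W.covA₃ 0 (.inl k) (.inr l) t := by
  have h := congrArg (W.e t) (hW.covA₂_swap k l)
  rw [W.e_covA₂, W.e_covA₂] at h
  simp only [Fin.sum_univ_two, hW.covA₂_swap, hW.covA₂_one, Pi.zero_apply, zero_mul, add_zero,
    frameConn, Fintype.sum_sum_type, mul_zero, Finset.sum_const_zero, zero_add] at h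
  linear_combination h

lemma covA₃_X₁_X₁ (t : Fin 2 ⊕ Fin 2) :
    W.covA₃ 0 X₁ X₁ t = 2 * δS t + W.covA 0 t * (2 * q₁ - p₁)
      + a₁ * (2 * W.covA₂ 0 Y₁ t - W.covA₂ 0 X₁ t) := by
  have h := congrArg (W.e t) hW.covA₂_X₁_X₁
  simp only [W.e_covA₂, Fin.sum_univ_two, hW.covA₂_one, Pi.zero_apply, zero_mul, add_zero,
    frameConn, Fintype.sum_sum_type, mul_zero, Finset.sum_const_zero, map_add, Derivation.leibniz,
    zero_add, smul_eq_mul, derivation_ofNat_eq_zero, map_sub, hW.e_q₁, hW.e_p₁, hW.e_a₁] at h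
  linear_combination h - 3 * γ t * hW.covA₂_X₁_X₁ - α t * (hW.covA₂_X₁_X₂ + hW.covA₂_X₂_X₁)

lemma covA₃_X₁_X₂ (t : Fin 2 ⊕ Fin 2) :
    W.covA₃ 0 X₁ X₂ t = δF t + δG t + W.covA 0 t * q₂ + a₁ * W.covA₂ 0 Y₂ t := by
  have h := congrArg (W.e t) hW.covA₂_X₁_X₂
  simp only [W.e_covA₂, Fin.sum_univ_two, hW.covA₂_one, Pi.zero_apply, zero_mul, add_zero,
    frameConn, Fintype.sum_sum_type, mul_zero, Finset.sum_const_zero, hW.w_eq_zero, zero_add,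
    map_add, Derivation.leibniz, hW.e_q₂, smul_eq_mul, hW.e_a₁] at h
  linear_combination h - (2 * γ t + β t) * hW.covA₂_X₁_X₂ - α t * hW.covA₂_X₂_X₂

lemma covA₃_X₂_X₁ (t : Fin 2 ⊕ Fin 2) :
    W.covA₃ 0 X₂ X₁ t = δF t + δG t + W.covA 0 t * (q₂ - p₂)
      + a₁ * (W.covA₂ 0 Y₂ t - W.covA₂ 0 X₂ t) := by
  have h := congrArg (W.e t) hW.covA₂_X₂_X₁
  simp only [W.e_covA₂, Fin.sum_univ_two, hW.covA₂_one, Pi.zero_apply, zero_mul, add_zero,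
    frameConn, Fintype.sum_sum_type, hW.w_eq_zero, mul_zero, zero_add, Finset.sum_const_zero,
    map_add, Derivation.leibniz, map_sub, hW.e_q₂, hW.e_p₂, smul_eq_mul, hW.e_a₁] at h
  linear_combination h - (2 * γ t + β t) * hW.covA₂_X₂_X₁ - α t * hW.covA₂_X₂_X₂

lemma covA₃_X₂_X₂ (t : Fin 2 ⊕ Fin 2) : W.covA₃ 0 X₂ X₂ t = 2 * δB t := by
  have h := congrArg (W.e t) hW.covA₂_X₂_X₂
  simp only [W.e_covA₂, Fin.sum_univ_two, hW.covA₂_one, Pi.zero_apply, zero_mul, add_zero,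
    frameConn, Fintype.sum_sum_type, hW.w_eq_zero, mul_zero, zero_add, Finset.sum_const_zero,
    Derivation.leibniz, smul_eq_mul, derivation_ofNat_eq_zero] at h
  linear_combination h - (γ t + 2 * β t) * hW.covA₂_X₂_X₂

lemma covA₃_Y₁_Y₁ (t : Fin 2 ⊕ Fin 2) :
    W.covA₃ 0 Y₁ Y₁ t = 2 * δS t - W.covA 0 t * (2 * p₁ - q₁)
      - a₁ * (2 * W.covA₂ 0 X₁ t - W.covA₂ 0 Y₁ t) := by
  have h := congrArg (W.e t) hW.covA₂_Y₁_Y₁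
  simp only [W.e_covA₂, Fin.sum_univ_two, hW.covA₂_one, Pi.zero_apply, zero_mul, add_zero,
    frameConn, Fintype.sum_sum_type, mul_zero, Finset.sum_const_zero, zero_add, map_sub,
    Derivation.leibniz, smul_eq_mul, derivation_ofNat_eq_zero, hW.e_p₁, hW.e_q₁, hW.e_a₁] at h
  linear_combination h - 3 * γ t * hW.covA₂_Y₁_Y₁ - α t * (hW.covA₂_Y₁_Y₂ + hW.covA₂_Y₂_Y₁)

lemma covA₃_Y₁_Y₂ (t : Fin 2 ⊕ Fin 2) :
    W.covA₃ 0 Y₁ Y₂ t = δF t + δG t - W.covA 0 t * p₂ - a₁ * W.covA₂ 0 X₂ t := by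
  have h := congrArg (W.e t) hW.covA₂_Y₁_Y₂
  simp only [W.e_covA₂, Fin.sum_univ_two, hW.covA₂_one, Pi.zero_apply, zero_mul, add_zero,
    frameConn, Fintype.sum_sum_type, mul_zero, Finset.sum_const_zero, zero_add, hW.w_eq_zero,
    map_sub, map_add, Derivation.leibniz, hW.e_p₂, smul_eq_mul, hW.e_a₁] at h
  linear_combination h - (2 * γ t + β t) * hW.covA₂_Y₁_Y₂ - α t * hW.covA₂_Y₂_Y₂

lemma covA₃_Y₂_Y₁ (t : Fin 2 ⊕ Fin 2) :
    W.covA₃ 0 Y₂ Y₁ t = δF t + δG t + W.covA 0 t * (q₂ - p₂)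
      + a₁ * (W.covA₂ 0 Y₂ t - W.covA₂ 0 X₂ t) := by
  have h := congrArg (W.e t) hW.covA₂_Y₂_Y₁
  simp only [W.e_covA₂, Fin.sum_univ_two, hW.covA₂_one, Pi.zero_apply, zero_mul, add_zero,
    frameConn, Fintype.sum_sum_type, mul_zero, Finset.sum_const_zero, hW.w_eq_zero, zero_add,
    map_add, Derivation.leibniz, map_sub, hW.e_q₂, hW.e_p₂, smul_eq_mul, hW.e_a₁] at h
  linear_combination h - (2 * γ t + β t) * hW.covA₂_Y₂_Y₁ - α t * hW.covA₂_Y₂_Y₂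

lemma covA₃_Y₂_Y₂ (t : Fin 2 ⊕ Fin 2) : W.covA₃ 0 Y₂ Y₂ t = 2 * δB t := by
  have h := congrArg (W.e t) hW.covA₂_Y₂_Y₂
  simp only [W.e_covA₂, Fin.sum_univ_two, hW.covA₂_one, Pi.zero_apply, zero_mul, add_zero,
    frameConn, Fintype.sum_sum_type, mul_zero, Finset.sum_const_zero, hW.w_eq_zero, zero_add,
    Derivation.leibniz, smul_eq_mul, derivation_ofNat_eq_zero] at h
  linear_combination h - (γ t + 2 * β t) * hW.covA₂_Y₂_Y₂

lemma ricci_X₁_X₂_Y₁ : 3 * (δS X₂ - δF Y₁ - δG Y₁) =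
      3 * a₁ * (F + G) - 3 * a₁ ^ 2 * (p₂ - q₂) + p₁ * p₂ - 2 * p₂ * q₁ + 3 * q₁ * q₂ := by
  have h := W.covA₃_sub_covA₃ 0 X₁ X₂ Y₁
  obtain ⟨-, -, b₃⟩ := hW.three_mul_b_zero
  simp only [hW.covA₃_X₁_X₂, hW.covA₂_Y₂_Y₁, webTorsion, zero_mul, Finset.sum_const_zero,
    curv_inl_inr, Fin.sum_univ_two, hW.b_zero, mul_zero, hW.covA_one, Pi.zero_apply, add_zero,
    sub_self, frameConn, Fintype.sum_sum_type, zero_add, zero_sub] at h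
  linear_combination 3 * h - p₂ * b₃

lemma ricci_X₁_X₁_Y₂ : 3 * (δG X₁ - 2 * δS Y₂) =
      3 * a₁ * (2 * F + G) - 6 * a₁ ^ 2 * p₂ - 2 * p₁ * p₂ - 3 * p₁ * q₂ + p₂ * q₁
        + 6 * q₁ * q₂ := by
  have h := W.covA₃_sub_covA₃ 0 X₁ X₁ Y₂
  obtain ⟨-, b₂, -⟩ := hW.three_mul_b_zero
  simp only [hW.covA₃_X₁_X₁, hW.covA₂_Y₁_Y₂, webTorsion, zero_mul, Finset.sum_const_zero,
    curv_inl_inr, Fin.sum_univ_two, hW.b_zero, mul_zero, hW.covA_one, Pi.zero_apply, add_zero,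
    sub_self, frameConn, Fintype.sum_sum_type, zero_add, zero_sub] at h
  linear_combination 3 * h - p₂ * b₂

lemma ricci_Y₁_Y₁_Y₂ :
    δF Y₁ + δG Y₁ - 2 * δS Y₂ = 3 * a₁ * F - 2 * a₁ ^ 2 * p₂ - 2 * p₁ * q₂ + p₂ * q₁ + q₁ * q₂ := by
  have h := W.covA₃_sub_covA₃ 0 Y₁ Y₁ Y₂
  simp only [hW.covA₃_Y₁_Y₂, hW.covA₃_Y₁_Y₁, hW.covA₂_Y₁_Y₂, webTorsion, Fintype.sum_sum_type,
    hW.covA₂_swap, zero_mul, Finset.sum_const_zero, hW.a_eq_zero, ite_self, sub_zero, ite_mul,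
    Finset.sum_ite_eq, Finset.mem_univ, ↓reduceIte, zero_add, curv_inr_inr, mul_zero, frameConn,
    Pi.zero_apply, add_zero] at h
  linear_combination h

lemma ricci_X₁_X₁_X₂ :
    2 * δS X₂ - δF X₁ - δG X₁ = 3 * a₁ * G + 2 * a₁ ^ 2 * q₂ + p₁ * p₂ + p₁ * q₂ - 2 * p₂ * q₁ := by
  have h := W.covA₃_sub_covA₃ 0 X₁ X₁ X₂
  simp only [hW.covA₃_X₁_X₂, hW.covA₂_swap, hW.covA₃_X₁_X₁, hW.covA₂_X₁_X₂, webTorsion,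
    Fintype.sum_sum_type, hW.a_eq_zero, ite_self, zero_sub, neg_mul, ite_mul, zero_mul,
    Finset.sum_neg_distrib, Finset.sum_ite_eq, Finset.mem_univ, ↓reduceIte, Finset.sum_const_zero,
    add_zero, curv_inl_inl, mul_zero, sub_zero, frameConn, Pi.zero_apply] at h
  linear_combination -h

lemma ricci_Y₁_X₁_X₂ : δS X₂ - δF X₁ = a₁ * F := by
  have h := W.covA₃_sub_covA₃ 0 Y₁ X₁ X₂
  simp only [hW.covA₃_swap, webTorsion, Fintype.sum_sum_type, hW.a_eq_zero, ite_self, zero_sub,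
    hW.covA₂_swap, neg_mul, ite_mul, zero_mul, Finset.sum_neg_distrib, Finset.sum_ite_eq,
    Finset.mem_univ, ↓reduceIte, Finset.sum_const_zero, add_zero, curv_inl_inl, mul_zero, sub_zero,
    frameConn, Pi.zero_apply] at h
  linear_combination -h

lemma ricci_X₂_X₂_Y₂ : δB X₂ = 2 * δB Y₂ := by
  have h := W.covA₃_sub_covA₃ 0 X₂ X₂ Y₂
  simp only [hW.covA₃_X₂_X₂, webTorsion, zero_mul, Finset.sum_const_zero, curv_inl_inr,
    Fin.sum_univ_two, hW.b_zero, mul_zero, hW.covA_one, Pi.zero_apply, add_zero, sub_self,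
    frameConn, Fintype.sum_sum_type, hW.b_one_one] at h
  linear_combination h

lemma ricci_Y₂_X₂_Y₂ : δB Y₂ = 2 * δB X₂ := by
  have h := W.covA₃_sub_covA₃ 0 Y₂ X₂ Y₂
  simp only [hW.covA₃_Y₂_Y₂, hW.covA₃_swap, webTorsion, zero_mul, Finset.sum_const_zero,
    curv_inl_inr, Fin.sum_univ_two, hW.b_zero, mul_zero, hW.covA_one, Pi.zero_apply, add_zero,
    sub_self, frameConn, Fintype.sum_sum_type, hW.b_one_one] at h
  linear_combination -h

lemma ricci_X₂_X₁_X₂ : δF X₂ + δG X₂ - 2 * δB X₁ = 3 * a₁ * B + p₂ ^ 2 - p₂ * q₂ := by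
  have h := W.covA₃_sub_covA₃ 0 X₂ X₁ X₂
  simp only [hW.covA₃_X₂_X₂, hW.covA₃_X₂_X₁, hW.covA₂_swap, hW.covA₂_X₂_X₂, webTorsion,
    Fintype.sum_sum_type, hW.a_eq_zero, ite_self, zero_sub, neg_mul, ite_mul, zero_mul,
    Finset.sum_neg_distrib, Finset.sum_ite_eq, Finset.mem_univ, ↓reduceIte, Finset.sum_const_zero,
    add_zero, curv_inl_inl, mul_zero, sub_zero, frameConn, Pi.zero_apply] at h
  linear_combination -h

lemma ricci_X₂_X₂_Y₁ : 3 * (δF X₂ - 2 * δB Y₁) = 2 * p₂ ^ 2 - p₂ * q₂ := by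
  have h := W.covA₃_sub_covA₃ 0 X₂ X₂ Y₁
  obtain ⟨-, c₂, -⟩ := hW.three_mul_b_one
  simp only [hW.covA₃_X₂_X₂, webTorsion, zero_mul, Finset.sum_const_zero, curv_inl_inr,
    Fin.sum_univ_two, hW.b_zero, mul_zero, hW.covA_one, Pi.zero_apply, add_zero, sub_self,
    frameConn, Fintype.sum_sum_type, zero_add, zero_sub] at h
  linear_combination 3 * h - p₂ * c₂

lemma ricci_X₂_Y₁_Y₂ : δF Y₂ - δB Y₁ = -(a₁ * B) := by
  have h := W.covA₃_sub_covA₃ 0 X₂ Y₁ Y₂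
  simp only [webTorsion, Fintype.sum_sum_type, zero_mul, Finset.sum_const_zero, hW.a_eq_zero,
    ite_self, sub_zero, ite_mul, Finset.sum_ite_eq, Finset.mem_univ, ↓reduceIte, zero_add,
    curv_inr_inr, mul_zero, frameConn, Pi.zero_apply, add_zero] at h
  linear_combination -h

lemma ricci_Y₂_X₁_X₂ : δG X₂ - δB X₁ = a₁ * B := by
  have h := W.covA₃_sub_covA₃ 0 Y₂ X₁ X₂
  simp only [hW.covA₃_swap, webTorsion, Fintype.sum_sum_type, hW.a_eq_zero, ite_self, zero_sub,
    hW.covA₂_swap, neg_mul, ite_mul, zero_mul, Finset.sum_neg_distrib, Finset.sum_ite_eq,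
    Finset.mem_univ, ↓reduceIte, Finset.sum_const_zero, add_zero, curv_inl_inl, mul_zero, sub_zero,
    frameConn, Pi.zero_apply] at h
  linear_combination -h

lemma ricci_Y₂_X₁_Y₂ : 3 * (δG Y₂ - 2 * δB X₁) = p₂ * q₂ - 2 * q₂ ^ 2 := by
  have h := W.covA₃_sub_covA₃ 0 Y₂ X₁ Y₂
  obtain ⟨-, -, c₃⟩ := hW.three_mul_b_one
  simp only [hW.covA₃_Y₂_Y₂, hW.covA₃_swap, webTorsion, zero_mul, Finset.sum_const_zero,
    curv_inl_inr, Fin.sum_univ_two, hW.b_zero, mul_zero, hW.covA_one, Pi.zero_apply, add_zero,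
    sub_self, frameConn, Fintype.sum_sum_type, zero_add, zero_sub] at h
  linear_combination -3 * h + q₂ * c₃

lemma ricci_Y₂_Y₁_Y₂ : δF Y₂ + δG Y₂ - 2 * δB Y₁ = -3 * a₁ * B + p₂ * q₂ - q₂ ^ 2 := by
  have h := W.covA₃_sub_covA₃ 0 Y₂ Y₁ Y₂
  simp only [hW.covA₃_Y₂_Y₂, hW.covA₃_Y₂_Y₁, hW.covA₂_Y₂_Y₂, webTorsion, Fintype.sum_sum_type,
    hW.covA₂_swap, zero_mul, Finset.sum_const_zero, hW.a_eq_zero, ite_self, sub_zero, ite_mul,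
    Finset.sum_ite_eq, Finset.mem_univ, ↓reduceIte, zero_add, curv_inr_inr, mul_zero, frameConn,
    Pi.zero_apply, add_zero] at h
  linear_combination -h

lemma nine_mul_δB_X₁ :
    9 * δB X₁ = -6 * a₁ * B + p₂ ^ 2 + 2 * p₂ * q₂ - 2 * q₂ ^ 2 := by
  linear_combination -2 * hW.ricci_Y₂_X₁_Y₂ - 6 * hW.ricci_X₂_Y₁_Y₂ - hW.ricci_X₂_X₂_Y₁
    + 3 * hW.ricci_X₂_X₁_X₂ + 6 * hW.ricci_Y₂_Y₁_Y₂ - 3 * hW.ricci_Y₂_X₁_X₂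

lemma nine_mul_δB_Y₁ :
    9 * δB Y₁ = 6 * a₁ * B + 2 * p₂ ^ 2 - 2 * p₂ * q₂ - q₂ ^ 2 := by
  linear_combination -hW.ricci_Y₂_X₁_Y₂ - 3 * hW.ricci_X₂_Y₁_Y₂ - 2 * hW.ricci_X₂_X₂_Y₁
    + 6 * hW.ricci_X₂_X₁_X₂ + 3 * hW.ricci_Y₂_Y₁_Y₂ - 6 * hW.ricci_Y₂_X₁_X₂

lemma nine_mul_δF_X₂ :
    9 * δF X₂ = 12 * a₁ * B + 10 * p₂ ^ 2 - 7 * p₂ * q₂ - 2 * q₂ ^ 2 := by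
  linear_combination -2 * hW.ricci_Y₂_X₁_Y₂ - 6 * hW.ricci_X₂_Y₁_Y₂ - hW.ricci_X₂_X₂_Y₁
    + 12 * hW.ricci_X₂_X₁_X₂ + 6 * hW.ricci_Y₂_Y₁_Y₂ - 12 * hW.ricci_Y₂_X₁_X₂

lemma nine_mul_δG_X₂ :
    9 * δG X₂ = 3 * a₁ * B + p₂ ^ 2 + 2 * p₂ * q₂ - 2 * q₂ ^ 2 := by
  linear_combination -2 * hW.ricci_Y₂_X₁_Y₂ - 6 * hW.ricci_X₂_Y₁_Y₂ - hW.ricci_X₂_X₂_Y₁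
    + 3 * hW.ricci_X₂_X₁_X₂ + 6 * hW.ricci_Y₂_Y₁_Y₂ + 6 * hW.ricci_Y₂_X₁_X₂

lemma nine_mul_δF_Y₂ :
    9 * δF Y₂ = -3 * a₁ * B + 2 * p₂ ^ 2 - 2 * p₂ * q₂ - q₂ ^ 2 := by
  linear_combination -hW.ricci_Y₂_X₁_Y₂ + 6 * hW.ricci_X₂_Y₁_Y₂ - 2 * hW.ricci_X₂_X₂_Y₁
    + 6 * hW.ricci_X₂_X₁_X₂ + 3 * hW.ricci_Y₂_Y₁_Y₂ - 6 * hW.ricci_Y₂_X₁_X₂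

lemma nine_mul_δG_Y₂ :
    9 * δG Y₂ = -12 * a₁ * B + 2 * p₂ ^ 2 + 7 * p₂ * q₂ - 10 * q₂ ^ 2 := by
  linear_combination -hW.ricci_Y₂_X₁_Y₂ - 12 * hW.ricci_X₂_Y₁_Y₂ - 2 * hW.ricci_X₂_X₂_Y₁
    + 6 * hW.ricci_X₂_X₁_X₂ + 12 * hW.ricci_Y₂_Y₁_Y₂ - 6 * hW.ricci_Y₂_X₁_X₂

variable [IsAddTorsionFree A]

lemma δB_X₂ : δB X₂ = 0 := by
  refine eq_zero_of_ofNat_mul 3 ?_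
  linear_combination -hW.ricci_X₂_X₂_Y₂ - 2 * hW.ricci_Y₂_X₂_Y₂

lemma δB_Y₂ : δB Y₂ = 0 := by
  refine eq_zero_of_ofNat_mul 3 ?_
  linear_combination -2 * hW.ricci_X₂_X₂_Y₂ - hW.ricci_Y₂_X₂_Y₂

-- The combination of the Ricci identities in which all third derivatives cancel. Along `X₂` and
-- `Y₂` the derivatives of `F`, `G` and `B` are known, so it can be differentiated along them.
lemma compatibility :
    3 * a₁ * (G - F) + a₁ ^ 2 * (p₂ + q₂) + 2 * (p₁ * q₂ - p₂ * q₁) = 0 := by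
  refine eq_zero_of_ofNat_mul 3 ?_
  linear_combination hW.ricci_X₁_X₂_Y₁ - hW.ricci_X₁_X₁_Y₂ + 3 * hW.ricci_Y₁_Y₁_Y₂
    - 3 * hW.ricci_X₁_X₁_X₂ + 3 * hW.ricci_Y₁_X₁_X₂

lemma compatibility_X₂ :
    2 * B * (p₁ - 2 * q₁) - F * (5 * p₂ - 2 * q₂) + G * (3 * p₂ + 2 * q₂)
      - a₁ * (p₂ ^ 2 - 5 * p₂ * q₂ - 2 * q₂ ^ 2) = 0 := by
  have h := congrArg (W.e X₂) hW.compatibility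
  simp only [map_add, Derivation.leibniz, map_sub, hW.e_G, hW.e_F, smul_eq_mul, hW.e_a₁,
    derivation_ofNat_eq_zero, mul_zero, add_zero, hW.e_p₂, hW.covA₂_X₂_X₂, hW.e_q₂, hW.covA₂_swap,
    Derivation.leibniz_pow, Nat.add_one_sub_one, pow_one, nsmul_eq_mul, Nat.cast_ofNat, hW.e_p₁,
    hW.covA₂_X₁_X₂, hW.e_q₁, map_zero] at h
  refine eq_zero_of_ofNat_mul 3 ?_
  linear_combination 3 * h + a₁ * hW.nine_mul_δF_X₂ - a₁ * hW.nine_mul_δG_X₂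
    - 3 * (3 * γ X₂ + β X₂) * hW.compatibility

lemma compatibility_Y₂ :
    2 * B * (2 * p₁ - q₁) - F * (2 * p₂ + 3 * q₂) - G * (2 * p₂ - 5 * q₂)
      + a₁ * (2 * p₂ ^ 2 + 5 * p₂ * q₂ - q₂ ^ 2) = 0 := by
  have h := congrArg (W.e Y₂) hW.compatibility
  simp only [map_add, Derivation.leibniz, map_sub, hW.e_G, hW.e_F, smul_eq_mul, hW.e_a₁,
    derivation_ofNat_eq_zero, mul_zero, add_zero, hW.e_p₂, hW.e_q₂, hW.covA₂_Y₂_Y₂,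
    Derivation.leibniz_pow, Nat.add_one_sub_one, pow_one, nsmul_eq_mul, Nat.cast_ofNat, hW.e_p₁,
    hW.e_q₁, hW.covA₂_Y₁_Y₂, map_zero] at h
  refine eq_zero_of_ofNat_mul 3 ?_
  linear_combination 3 * h + a₁ * hW.nine_mul_δF_Y₂ - a₁ * hW.nine_mul_δG_Y₂
    - 3 * (3 * γ Y₂ + β Y₂) * hW.compatibility

lemma compatibility_X₂_X₂ :
    3 * B * (15 * (G - F) - 7 * a₁ * p₂ + 29 * a₁ * q₂)
      - 28 * p₂ ^ 3 + 54 * p₂ ^ 2 * q₂ + 6 * p₂ * q₂ ^ 2 - 4 * q₂ ^ 3 = 0 := by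
  have h := congrArg (W.e X₂) hW.compatibility_X₂
  simp only [map_sub, map_add, Derivation.leibniz, hW.e_p₁, hW.covA₂_X₁_X₂, hW.e_q₁, hW.covA₂_swap,
    smul_eq_mul, derivation_ofNat_eq_zero, mul_zero, add_zero, hW.e_B, hW.e_p₂, hW.covA₂_X₂_X₂,
    hW.e_q₂, hW.e_F, hW.e_G, Derivation.leibniz_pow, Nat.add_one_sub_one, pow_one, nsmul_eq_mul,
    Nat.cast_ofNat, hW.e_a₁, map_zero] at h
  refine eq_zero_of_ofNat_mul 2 ?_
  linear_combination 9 * h + (5 * p₂ - 2 * q₂) * hW.nine_mul_δF_X₂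
    - (3 * p₂ + 2 * q₂) * hW.nine_mul_δG_X₂ - 18 * (p₁ - 2 * q₁) * hW.δB_X₂
    - 9 * (3 * γ X₂ + 2 * β X₂) * hW.compatibility_X₂

lemma compatibility_Y₂_Y₂ :
    3 * B * (15 * (G - F) + 29 * a₁ * p₂ - 7 * a₁ * q₂)
      - 4 * p₂ ^ 3 + 6 * p₂ ^ 2 * q₂ + 54 * p₂ * q₂ ^ 2 - 28 * q₂ ^ 3 = 0 := by
  have h := congrArg (W.e Y₂) hW.compatibility_Y₂
  simp only [map_add, map_sub, Derivation.leibniz, hW.e_p₁, smul_eq_mul, derivation_ofNat_eq_zero,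
    mul_zero, add_zero, hW.e_q₁, hW.covA₂_Y₁_Y₂, hW.e_B, hW.e_p₂, hW.e_q₂, hW.covA₂_Y₂_Y₂, hW.e_F,
    hW.e_G, Derivation.leibniz_pow, Nat.add_one_sub_one, pow_one, nsmul_eq_mul, Nat.cast_ofNat,
    hW.e_a₁, map_zero] at h
  refine eq_zero_of_ofNat_mul 2 ?_
  linear_combination 9 * h + (2 * p₂ + 3 * q₂) * hW.nine_mul_δF_Y₂
    - (-2 * p₂ + 5 * q₂) * hW.nine_mul_δG_Y₂ - 18 * (2 * p₁ - q₁) * hW.δB_Y₂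
    - 9 * (3 * γ Y₂ + 2 * β Y₂) * hW.compatibility_Y₂

lemma B_mul_p₂_sq : B * p₂ ^ 2 = 2 * (B * (p₂ * q₂)) := by
  have h := congrArg (W.e X₂) hW.compatibility_X₂_X₂
  simp only [map_sub, map_add, Derivation.leibniz, hW.e_G, hW.e_F, smul_eq_mul,
    derivation_ofNat_eq_zero, mul_zero, add_zero, hW.e_p₂, hW.covA₂_X₂_X₂, hW.e_a₁, hW.e_q₂,
    hW.covA₂_swap, hW.e_B, Derivation.leibniz_pow, Nat.add_one_sub_one, nsmul_eq_mul,
    Nat.cast_ofNat, pow_one, map_zero] at h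
  refine sub_eq_zero.1 (eq_zero_of_ofNat_mul 180 ?_)
  linear_combination -h + (45 * (G - F) - 21 * a₁ * p₂ + 87 * a₁ * q₂) * hW.δB_X₂
    - 5 * B * hW.nine_mul_δF_X₂ + 5 * B * hW.nine_mul_δG_X₂
    + 3 * (γ X₂ + β X₂) * hW.compatibility_X₂_X₂

lemma B_mul_q₂_sq : B * q₂ ^ 2 = 2 * (B * (p₂ * q₂)) := by
  have h := congrArg (W.e Y₂) hW.compatibility_Y₂_Y₂
  simp only [map_sub, map_add, Derivation.leibniz, hW.e_G, hW.e_F, smul_eq_mul,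
    derivation_ofNat_eq_zero, mul_zero, add_zero, hW.e_p₂, hW.e_a₁, hW.e_q₂, hW.covA₂_Y₂_Y₂, hW.e_B,
    Derivation.leibniz_pow, Nat.add_one_sub_one, nsmul_eq_mul, Nat.cast_ofNat, pow_one, map_zero]
      at h
  refine sub_eq_zero.1 (eq_zero_of_ofNat_mul 180 ?_)
  linear_combination -h + (45 * (G - F) + 87 * a₁ * p₂ - 21 * a₁ * q₂) * hW.δB_Y₂
    - 5 * B * hW.nine_mul_δF_Y₂ + 5 * B * hW.nine_mul_δG_Y₂
    + 3 * (γ Y₂ + β Y₂) * hW.compatibility_Y₂_Y₂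

lemma B_eq_zero (hu : IsUnit (p₂ ^ 2 + q₂ ^ 2)) : B = 0 :=
  eq_zero_of_mul_quadratic hu hW.B_mul_p₂_sq hW.B_mul_q₂_sq

lemma not_isUnit [Nontrivial A] : ¬ IsUnit (p₂ ^ 2 + q₂ ^ 2) := by
  intro hu
  have hB := hW.B_eq_zero hu
  have δB_eq_zero (t : Fin 2 ⊕ Fin 2) : δB t = 0 := by simpa [hB] using (hW.e_B t).symm
  have hX := hW.nine_mul_δB_X₁
  have hY := hW.nine_mul_δB_Y₁
  rw [hB, δB_eq_zero] at hX hY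
  have hpq : p₂ ^ 2 - q₂ ^ 2 = 0 := by
    refine eq_zero_of_ofNat_mul 3 ?_
    linear_combination -hX - hY
  have hq : q₂ ^ 4 = 0 := by
    refine eq_zero_of_ofNat_mul 3 ?_
    linear_combination -(2 * p₂ * q₂ + q₂ ^ 2) * (hX + hpq) - 4 * q₂ ^ 2 * hpq
  refine (hu.pow 2).ne_zero ?_
  linear_combination (p₂ ^ 2 + 3 * q₂ ^ 2) * hpq + 4 * hq

end IsReduced

lemma IsSpecial.not_isUnit [Nontrivial A] [IsAddTorsionFree A] (hW : W.IsSpecial) :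
    ¬ IsUnit (W.covA 0 X₂ ^ 2 + W.covA 0 Y₂ ^ 2) := fun hu =>
  have ⟨hw, ha⟩ := hW.w_and_a_eq_zero hu
  IsReduced.not_isUnit ⟨hW, hw, ha⟩ hu

end WebFrame

end SpecialWebs

section SmoothFunctions

open TopologicalSpace

variable {E F : Type*} [NormedAddCommGroup E] [NormedSpace ℝ E] [NormedAddCommGroup F]
  [NormedSpace ℝ F] {U : Set E} {g : E → F} {e f : E → E} {y : E}

lemma differentiableAt_of_contDiffOn (hU : IsOpen U) (hg : ContDiffOn ℝ ∞ g U) (hy : y ∈ U) :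
    DifferentiableAt ℝ g y :=
  (hg.contDiffAt (hU.mem_nhds hy)).differentiableAt (by simp)

lemma isSymmSndFDerivAt_of_contDiffAt (hg : ContDiffAt ℝ ∞ g y) : IsSymmSndFDerivAt ℝ g y :=
  hg.isSymmSndFDerivAt (by simpa using WithTop.coe_le_coe.2 (le_top : (2 : ℕ∞) ≤ ⊤))

lemma contDiffOn_fderiv (hU : IsOpen U) (hg : ContDiffOn ℝ ∞ g U) :
    ContDiffOn ℝ ∞ (fderiv ℝ g) U :=
  hg.fderiv_of_isOpen hU (by simp)

lemma contDiffOn_fderiv_apply (hU : IsOpen U) (hg : ContDiffOn ℝ ∞ g U)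
    (he : ContDiffOn ℝ ∞ e U) : ContDiffOn ℝ ∞ (fun y => fderiv ℝ g y (e y)) U :=
  (contDiffOn_fderiv hU hg).clm_apply he

lemma contDiffOn_lieBracket (hU : IsOpen U) (he : ContDiffOn ℝ ∞ e U) (hf : ContDiffOn ℝ ∞ f U) :
    ContDiffOn ℝ ∞ (VectorField.lieBracket ℝ e f) U :=
  (contDiffOn_fderiv_apply hU hf he).sub (contDiffOn_fderiv_apply hU he hf)

lemma fderiv_fderiv_apply (hU : IsOpen U) (hg : ContDiffOn ℝ ∞ g U) (he : ContDiffOn ℝ ∞ e U)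
    (hy : y ∈ U) (v : E) :
    fderiv ℝ (fun z => fderiv ℝ g z (e z)) y v =
      fderiv ℝ (fderiv ℝ g) y v (e y) + fderiv ℝ g y (fderiv ℝ e y v) := by
  rw [fderiv_clm_apply (differentiableAt_of_contDiffOn hU (contDiffOn_fderiv hU hg) hy)
    (differentiableAt_of_contDiffOn hU he hy)]
  simp [add_comm]

/-- The algebra of smooth real functions on an open subset of a normed space. -/
def smoothFunctions (V : Opens E) : Subalgebra ℝ (V → ℝ) where
  carrier := {f | ∃ g : E → ℝ, ContDiffOn ℝ ∞ g V ∧ f = fun y : V => g y}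
  mul_mem' := by
    rintro _ _ ⟨g, hg, rfl⟩ ⟨h, hh, rfl⟩
    exact ⟨fun y => g y * h y, hg.mul hh, rfl⟩
  add_mem' := by
    rintro _ _ ⟨g, hg, rfl⟩ ⟨h, hh, rfl⟩
    exact ⟨fun y => g y + h y, hg.add hh, rfl⟩
  algebraMap_mem' r := ⟨fun _ => r, contDiffOn_const, rfl⟩

namespace smoothFunctions

variable {V : Opens E} {ι : Type*} [Fintype ι]

instance : IsAddTorsionFree (smoothFunctions V) := .of_isTorsionFree ℝ _

/-- The restriction to `V` of a function that is smooth on `V`. -/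
def mk (g : E → ℝ) (hg : ContDiffOn ℝ ∞ g V) : smoothFunctions V :=
  ⟨fun y => g y, g, hg, rfl⟩

/-- Evaluation at a point. -/
def eval (y : V) : smoothFunctions V →+* ℝ :=
  (Pi.evalRingHom (fun _ : V => ℝ) y).comp (smoothFunctions V).subtype

@[simp]
lemma eval_mk (g : E → ℝ) (hg : ContDiffOn ℝ ∞ g V) (y : V) : eval y (mk g hg) = g y := rfl

lemma ext_eval {f g : smoothFunctions V} (h : ∀ y, eval y f = eval y g) : f = g :=
  Subtype.ext (funext h)

lemma exists_eq_mk (f : smoothFunctions V) : ∃ g hg, f = mk g hg := by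
  obtain ⟨f, g, hg, rfl⟩ := f
  exact ⟨g, hg, rfl⟩

/-- The directional derivative of a smooth function along a vector field; it does not depend on
the chosen extension of the function. -/
def dirDeriv (e : E → E) (he : ContDiffOn ℝ ∞ e V) (f : smoothFunctions V) : smoothFunctions V :=
  mk (fun y => fderiv ℝ (exists_eq_mk f).choose y (e y))
    (contDiffOn_fderiv_apply V.isOpen (exists_eq_mk f).choose_spec.choose he)

lemma dirDeriv_mk (he : ContDiffOn ℝ ∞ e V) (g : E → ℝ) (hg : ContDiffOn ℝ ∞ g V) :
    dirDeriv e he (mk g hg) =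
      mk (fun y => fderiv ℝ g y (e y)) (contDiffOn_fderiv_apply V.isOpen hg he) := by
  refine ext_eval fun y => ?_
  have hc := (exists_eq_mk (mk g hg)).choose_spec.choose_spec
  have hg' : (exists_eq_mk (mk g hg)).choose =ᶠ[𝓝 (y : E)] g := by
    filter_upwards [V.isOpen.mem_nhds y.2] with z hz
    exact (congrArg (eval ⟨z, hz⟩) hc).symm
  rw [dirDeriv, eval_mk, hg'.fderiv_eq, eval_mk]

/-- A smooth vector field as a derivation of the algebra of smooth functions. -/
def vectorField (e : E → E) (he : ContDiffOn ℝ ∞ e V) :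
    Derivation ℝ (smoothFunctions V) (smoothFunctions V) :=
  Derivation.mk'
    { toFun := dirDeriv e he
      map_add' := by
        intro f₁ f₂
        obtain ⟨g₁, h₁, rfl⟩ := exists_eq_mk f₁
        obtain ⟨g₂, h₂, rfl⟩ := exists_eq_mk f₂
        refine ext_eval fun y => ?_
        change eval y (dirDeriv e he (mk (fun y => g₁ y + g₂ y) (h₁.add h₂))) = _
        simp only [dirDeriv_mk, map_add, eval_mk]
        rw [fderiv_fun_add (differentiableAt_of_contDiffOn V.isOpen h₁ y.2)
          (differentiableAt_of_contDiffOn V.isOpen h₂ y.2), add_apply]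
      map_smul' := by
        intro c f
        obtain ⟨g, hg, rfl⟩ := exists_eq_mk f
        refine ext_eval fun y => ?_
        change eval y (dirDeriv e he (mk (fun y => c * g y) (contDiffOn_const.mul hg))) =
          c * eval y (dirDeriv e he (mk g hg))
        simp only [dirDeriv_mk, eval_mk]
        rw [fderiv_const_mul (differentiableAt_of_contDiffOn V.isOpen hg y.2)]
        rfl }
    (by
      intro f₁ f₂
      obtain ⟨g₁, h₁, rfl⟩ := exists_eq_mk f₁
      obtain ⟨g₂, h₂, rfl⟩ := exists_eq_mk f₂
      refine ext_eval fun y => ?_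
      change eval y (dirDeriv e he (mk (fun y => g₁ y * g₂ y) (h₁.mul h₂))) =
        g₁ y * eval y (dirDeriv e he (mk g₂ h₂)) + g₂ y * eval y (dirDeriv e he (mk g₁ h₁))
      simp only [dirDeriv_mk, eval_mk]
      rw [fderiv_fun_mul (differentiableAt_of_contDiffOn V.isOpen h₁ y.2)
        (differentiableAt_of_contDiffOn V.isOpen h₂ y.2)]
      rfl)

lemma eval_vectorField_mk (he : ContDiffOn ℝ ∞ e V) (g : E → ℝ) (hg : ContDiffOn ℝ ∞ g V)
    (y : V) : eval y (vectorField e he (mk g hg)) = fderiv ℝ g y (e y) :=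
  congrArg (eval y) (dirDeriv_mk he g hg)

lemma bracket_vectorField (he : ContDiffOn ℝ ∞ e V) (hf : ContDiffOn ℝ ∞ f V) :
    ⁅vectorField e he, vectorField f hf⁆ =
      vectorField (VectorField.lieBracket ℝ e f) (contDiffOn_lieBracket V.isOpen he hf) := by
  refine Derivation.ext fun a => ext_eval fun y => ?_
  obtain ⟨g, hg, rfl⟩ := exists_eq_mk a
  have hmk {e : E → E} (he : ContDiffOn ℝ ∞ e V) : vectorField e he (mk g hg) = mk _ _ :=
    dirDeriv_mk he g hg
  rw [Derivation.commutator_apply, map_sub, hmk, hmk]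
  simp only [eval_vectorField_mk]
  rw [fderiv_fderiv_apply V.isOpen hg hf y.2, fderiv_fderiv_apply V.isOpen hg he y.2,
    isSymmSndFDerivAt_of_contDiffAt (hg.contDiffAt (V.isOpen.mem_nhds y.2)) (e y) (f y)]
  simp [VectorField.lieBracket]

lemma vectorField_eq_sum (he : ContDiffOn ℝ ∞ e V) {f : ι → E → E}
    (hf : ∀ i, ContDiffOn ℝ ∞ (f i) V) {c : ι → smoothFunctions V}
    (h : ∀ y : V, e y = ∑ i, eval y (c i) • f i y) :
    vectorField e he = ∑ i, c i • vectorField (f i) (hf i) := by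
  refine Derivation.ext fun a => ext_eval fun y => ?_
  obtain ⟨g, hg, rfl⟩ := exists_eq_mk a
  simp only [derivation_sum_smul_apply, map_sum, map_mul, eval_vectorField_mk, h y, map_smul,
    smul_eq_mul]

lemma linearIndependent_vectorField [DecidableEq ι] {f : ι → E → E}
    (hf : ∀ i, ContDiffOn ℝ ∞ (f i) V) {θ : ι → E → E →L[ℝ] ℝ}
    (hθ : ∀ y ∈ V, ∀ i j, θ i y (f j y) = if i = j then 1 else 0) (c : ι → smoothFunctions V)
    (h : ∑ i, c i • vectorField (f i) (hf i) = 0) (i : ι) : c i = 0 := by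
  refine ext_eval fun y => ?_
  have hL (L : E →L[ℝ] ℝ) : ∑ i, eval y (c i) * L (f i y) = 0 := by
    have := congrArg (fun D => eval y (D (mk L L.contDiff.contDiffOn))) h
    simpa only [derivation_sum_smul_apply, map_sum, map_mul, eval_vectorField_mk,
      ContinuousLinearMap.fderiv, Derivation.coe_zero, Pi.zero_apply, map_zero] using this
  simpa [hθ y y.2] using hL (θ i y)

end smoothFunctions

end SmoothFunctions

section Integrability

variable {E F : Type*} [NormedAddCommGroup E] [NormedSpace ℝ E] [NormedAddCommGroup F]
  [NormedSpace ℝ F]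

lemma apply_lieBracket_of_eventually_const {Φ : E → E →L[ℝ] F} {e f : E → E} {y : E} {c d : F}
    (hΦ : DifferentiableAt ℝ Φ y) (he : DifferentiableAt ℝ e y) (hf : DifferentiableAt ℝ f y)
    (hc : ∀ᶠ z in 𝓝 y, Φ z (e z) = c) (hd : ∀ᶠ z in 𝓝 y, Φ z (f z) = d) :
    Φ y (VectorField.lieBracket ℝ e f y) =
      fderiv ℝ Φ y (f y) (e y) - fderiv ℝ Φ y (e y) (f y) := by
  have leibniz {e : E → E} {c : F} (he : DifferentiableAt ℝ e y)
      (hc : ∀ᶠ z in 𝓝 y, Φ z (e z) = c) (v : E) :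
      Φ y (fderiv ℝ e y v) + fderiv ℝ Φ y v (e y) = 0 := by
    have hconst : (fun z => Φ z (e z)) =ᶠ[𝓝 y] fun _ => c := hc
    have hzero := congrArg (fun L : E →L[ℝ] F => L v) (hconst.fderiv_eq (𝕜 := ℝ))
    simpa [fderiv_clm_apply hΦ he] using hzero
  rw [VectorField.lieBracket, map_sub, eq_neg_of_add_eq_zero_left (leibniz hf hd (e y)),
    eq_neg_of_add_eq_zero_left (leibniz he hc (f y))]
  abel

namespace ThreeWeb

variable {θ : R4 → R4 →L[ℝ] ℝ} {e f : R4 → R4} {y : R4}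

lemma contDiffOn_extD {U : Set R4} (hU : IsOpen U) (hθ : ContDiffOn ℝ ∞ θ U)
    (he : ContDiffOn ℝ ∞ e U) (hf : ContDiffOn ℝ ∞ f U) :
    ContDiffOn ℝ ∞ (fun y => extD θ y (e y) (f y)) U :=
  have h := contDiffOn_fderiv hU hθ
  ((h.clm_apply he).clm_apply hf).sub ((h.clm_apply hf).clm_apply he)

lemma extD_swap (θ : R4 → R4 →L[ℝ] ℝ) (y u v : R4) : extD θ y u v = -extD θ y v u :=
  (neg_sub _ _).symm

lemma extD_sub_sub (θ : R4 → R4 →L[ℝ] ℝ) (y u u' v v' : R4) :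
    extD θ y (u - u') (v - v') =
      extD θ y u v - extD θ y u v' - extD θ y u' v + extD θ y u' v' := by
  simp only [extD, map_sub, sub_apply]
  ring

lemma extD_eq_lieBracket (hθ : DifferentiableAt ℝ θ y) (he : DifferentiableAt ℝ e y)
    (hf : DifferentiableAt ℝ f y) :
    extD θ y (e y) (f y) = fderiv ℝ (fun z => θ z (f z)) y (e y)
      - fderiv ℝ (fun z => θ z (e z)) y (f y) - θ y (VectorField.lieBracket ℝ e f y) := by
  rw [fderiv_clm_apply hθ hf, fderiv_clm_apply hθ he]
  simp only [extD, VectorField.lieBracket, add_apply, ContinuousLinearMap.comp_apply,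
    ContinuousLinearMap.flip_apply, map_sub]
  ring

lemma extD_eq_neg_apply_lieBracket {c d : ℝ} (hθ : DifferentiableAt ℝ θ y)
    (he : DifferentiableAt ℝ e y) (hf : DifferentiableAt ℝ f y)
    (hc : ∀ᶠ z in 𝓝 y, θ z (e z) = c) (hd : ∀ᶠ z in 𝓝 y, θ z (f z) = d) :
    extD θ y (e y) (f y) = -θ y (VectorField.lieBracket ℝ e f y) := by
  rw [apply_lieBracket_of_eventually_const hθ he hf hc hd, neg_sub, extD]

lemma extD_eq_zero_of_ker {u : R4 → F} (hθ : DifferentiableAt ℝ θ y) (hu : ContDiffAt ℝ ∞ u y)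
    (he : DifferentiableAt ℝ e y) (hf : DifferentiableAt ℝ f y)
    (hker : ∀ᶠ z in 𝓝 y, ∀ v, fderiv ℝ u z v = 0 → θ z v = 0)
    (hue : ∀ᶠ z in 𝓝 y, fderiv ℝ u z (e z) = 0) (huf : ∀ᶠ z in 𝓝 y, fderiv ℝ u z (f z) = 0) :
    extD θ y (e y) (f y) = 0 := by
  have hu' : DifferentiableAt ℝ (fderiv ℝ u) y :=
    (hu.fderiv_right (m := ∞) (by simp)).differentiableAt (by simp)
  have hbracket : fderiv ℝ u y (VectorField.lieBracket ℝ e f y) = 0 := by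
    rw [apply_lieBracket_of_eventually_const hu' he hf hue huf,
      isSymmSndFDerivAt_of_contDiffAt hu (f y) (e y), sub_self]
  have hθe : ∀ᶠ z in 𝓝 y, θ z (e z) = 0 := by
    filter_upwards [hker, hue] with z hz using hz _
  have hθf : ∀ᶠ z in 𝓝 y, θ z (f z) = 0 := by
    filter_upwards [hker, huf] with z hz using hz _
  rw [extD_eq_neg_apply_lieBracket hθ he hf hθe hθf, hker.self_of_nhds _ hbracket, neg_zero]

end ThreeWeb

end Integrability

section Coframe

open TopologicalSpace

variable {M : Type*} [TopologicalSpace M] [ChartedSpace R4 M]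

namespace ThreeWeb.AdaptedCoframe

variable {W : ThreeWeb M} (C : W.AdaptedCoframe) {y : R4}

lemma mdifferentiable_chart : C.chart.MDifferentiable 𝓘(ℝ, R4) 𝓘(ℝ, R4) :=
  ⟨(contMDiffOn_of_mem_maximalAtlas C.chart_mem).mdifferentiableOn (by simp),
    (contMDiffOn_symm_of_mem_maximalAtlas C.chart_mem).mdifferentiableOn (by simp)⟩

lemma mfderiv_chart_symm (hy : y ∈ C.chart.target) (v : R4) :
    mfderiv 𝓘(ℝ, R4) 𝓘(ℝ, R4) C.chart (C.chart.symm y)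
      (mfderiv 𝓘(ℝ, R4) 𝓘(ℝ, R4) C.chart.symm y v) = v :=
  congrArg (fun L : R4 →L[ℝ] R4 => L v) (C.mdifferentiable_chart.comp_symm_deriv hy)

/-- The one-forms `ω_ξⁱ` that define the foliation with the number `ξ`, where
`ω₁ⁱ + ω₂ⁱ + ω₃ⁱ = 0`. -/
def distForm (ξ : Fin 3) (i : Fin 2) (y : R4) : R4 →L[ℝ] ℝ :=
  match ξ with
  | 0 => C.form 0 i y
  | 1 => C.form 1 i y
  | 2 => -(C.form 0 i y + C.form 1 i y)

lemma mem_dist (ξ : Fin 3) {x : M} (hx : x ∈ C.chart.source) (v : TangentSpace 𝓘(ℝ, R4) x) :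
    v ∈ W.dist ξ x ↔
      ∀ i, C.distForm ξ i (C.chart x) (mfderiv 𝓘(ℝ, R4) 𝓘(ℝ, R4) C.chart x v) = 0 := by
  fin_cases ξ
  · exact C.mem_dist₁ x hx v
  · exact C.mem_dist₂ x hx v
  · exact C.mem_dist₃ x hx v

lemma mem_dist_symm (ξ : Fin 3) (hy : y ∈ C.chart.target) (v : R4) :
    (mfderiv 𝓘(ℝ, R4) 𝓘(ℝ, R4) C.chart.symm y v) ∈ W.dist ξ (C.chart.symm y) ↔
      ∀ i, C.distForm ξ i y v = 0 := by
  rw [C.mem_dist ξ (C.chart.map_target hy), C.chart.right_inv hy]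
  exact forall_congr' fun i =>
    Iff.of_eq (congrArg (fun w : R4 => C.distForm ξ i y w = 0) (C.mfderiv_chart_symm hy v))

lemma contDiffOn_distForm (ξ : Fin 3) (i : Fin 2) :
    ContDiffOn ℝ ∞ (C.distForm ξ i) C.chart.target := by
  fin_cases ξ
  · exact C.smooth 0 i
  · exact C.smooth 1 i
  · exact ((C.smooth 0 i).add (C.smooth 1 i)).neg

lemma exists_first_integral (ξ : Fin 3) (hy : y ∈ C.chart.target) :
    ∃ u : R4 → R2, ContDiffAt ℝ ∞ u y ∧
      ∀ᶠ z in 𝓝 y, ∀ v, fderiv ℝ u z v = 0 ↔ ∀ i, C.distForm ξ i z v = 0 := by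
  obtain ⟨V, u, hV, hyV, hu, hker⟩ := W.foliation ξ (C.chart.symm y)
  have hsymm (z : R4) (hz : z ∈ C.chart.target) :
      ContMDiffAt 𝓘(ℝ, R4) 𝓘(ℝ, R4) ∞ C.chart.symm z :=
    contMDiffAt_symm_of_mem_maximalAtlas C.chart_mem hz
  have hu' (x : M) (hx : x ∈ V) : ContMDiffAt 𝓘(ℝ, R4) 𝓘(ℝ, R2) ∞ u x :=
    (hu x hx).contMDiffAt (hV.mem_nhds hx)
  refine ⟨u ∘ C.chart.symm, ((hu' _ hyV).comp y (hsymm y hy)).contDiffAt, ?_⟩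
  filter_upwards [C.chart.open_target.mem_nhds hy,
    (C.chart.continuousAt_symm hy).preimage_mem_nhds (hV.mem_nhds hyV)] with z hz hzV v
  rw [← C.mem_dist_symm ξ hz, (hker _ hzV).2, ← mfderiv_eq_fderiv,
    mfderiv_comp z ((hu' _ hzV).mdifferentiableAt (by simp))
      ((hsymm z hz).mdifferentiableAt (by simp))]
  rfl

lemma extD_distForm (ξ : Fin 3) (i : Fin 2) (hy : y ∈ C.chart.target) {e f : R4 → R4}
    (he : ContDiffOn ℝ ∞ e C.chart.target) (hf : ContDiffOn ℝ ∞ f C.chart.target)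
    (hθe : ∀ z ∈ C.chart.target, ∀ k, C.distForm ξ k z (e z) = 0)
    (hθf : ∀ z ∈ C.chart.target, ∀ k, C.distForm ξ k z (f z) = 0) :
    extD (C.distForm ξ i) y (e y) (f y) = 0 := by
  obtain ⟨u, hu, hker⟩ := C.exists_first_integral ξ hy
  have hT := C.chart.open_target.mem_nhds hy
  refine extD_eq_zero_of_ker
    (differentiableAt_of_contDiffOn C.chart.open_target (C.contDiffOn_distForm ξ i) hy) hu
    (differentiableAt_of_contDiffOn C.chart.open_target he hy)
    (differentiableAt_of_contDiffOn C.chart.open_target hf hy)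
    (hker.mono fun z hz v hv => (hz v).1 hv i) ?_ ?_
  · filter_upwards [hker, hT] with z hz hzT using (hz _).2 (hθe z hzT)
  · filter_upwards [hker, hT] with z hz hzT using (hz _).2 (hθf z hzT)

lemma eq_zero_of_forms_eq_zero (hy : y ∈ C.chart.target) {v : R4}
    (h : ∀ α i, C.form α i y v = 0) : v = 0 := by
  have h₀ := (C.mem_dist_symm 0 hy v).2 fun i => h 0 i
  have h₁ := (C.mem_dist_symm 1 hy v).2 fun i => h 1 i
  rw [← C.mfderiv_chart_symm hy v, Submodule.disjoint_def.1
    (W.transversal (C.chart.symm y) 0 1 (by decide)) _ h₀ h₁, map_zero]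
  rfl

lemma isInvertible_coframeMap (hy : y ∈ C.chart.target) : (C.coframeMap y).IsInvertible := by
  have hinj : Function.Injective (C.coframeMap y) :=
    (injective_iff_map_eq_zero (C.coframeMap y)).2 fun v hv =>
      C.eq_zero_of_forms_eq_zero hy fun α i => congrFun (congrFun hv α) i
  have hdim : Module.finrank ℝ R4 = Module.finrank ℝ (Fin 2 → Fin 2 → ℝ) := by
    simp [Module.finrank_pi_fintype]
  exact ⟨(LinearEquiv.ofInjectiveOfFinrankEq (C.coframeMap y).toLinearMap hinj
    hdim).toContinuousLinearEquiv, rfl⟩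

lemma form_frame (hy : y ∈ C.chart.target) (α k β i : Fin 2) :
    C.form β i y (C.frame α k y) = if α = β ∧ k = i then 1 else 0 := by
  have h : C.form β i y (C.frame α k y) =
      (Pi.single α (Pi.single k 1) : Fin 2 → Fin 2 → ℝ) β i :=
    congrFun (congrFun ((C.isInvertible_coframeMap hy).self_apply_inverse _) β) i
  rw [h]
  fin_cases α <;> fin_cases β <;> fin_cases k <;> fin_cases i <;> simp

lemma contDiffOn_coframeMap : ContDiffOn ℝ ∞ C.coframeMap C.chart.target :=
  contDiffOn_clm_apply.2 fun _ => contDiffOn_pi.2 fun α => contDiffOn_pi.2 fun i =>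
    (C.smooth α i).clm_apply contDiffOn_const

lemma contDiffOn_frame (α k : Fin 2) : ContDiffOn ℝ ∞ (C.frame α k) C.chart.target :=
  fun y hy => ((C.isInvertible_coframeMap hy).contDiffAt_map_inverse.comp_contDiffWithinAt y
    (C.contDiffOn_coframeMap y hy)).clm_apply contDiffWithinAt_const

lemma contDiffOn_conn (j i : Fin 2) : ContDiffOn ℝ ∞ (C.conn j i) C.chart.target := by
  have hterm (α β k l : Fin 2) : ContDiffOn ℝ ∞ (fun y =>
      extD (C.form β i) y (C.frame β j y) (C.frame α k y) • C.form α l y) C.chart.target :=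
    (contDiffOn_extD C.chart.open_target (C.smooth β i) (C.contDiffOn_frame β j)
      (C.contDiffOn_frame α k)).smul (C.smooth α l)
  exact ContDiffOn.sum fun k _ => (hterm 0 1 k k).add (hterm 1 0 k k)

lemma contDiffOn_a (j : Fin 2) : ContDiffOn ℝ ∞ (C.a j) C.chart.target := by
  have hform (m k : Fin 2) := (C.smooth 0 m).clm_apply (C.contDiffOn_frame 0 k)
  have hconn (m k l : Fin 2) := (C.contDiffOn_conn m k).clm_apply (C.contDiffOn_frame 0 l)
  exact ContDiffOn.sum fun k _ => (contDiffOn_extD C.chart.open_target (C.smooth 0 k)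
    (C.contDiffOn_frame 0 j) (C.contDiffOn_frame 0 k)).sub (ContDiffOn.sum fun m _ =>
      ((hform m j).mul (hconn m k k)).sub ((hform m k).mul (hconn m k j)))

lemma conn_frame_zero (hy : y ∈ C.chart.target) (j i k : Fin 2) :
    C.conn j i y (C.frame 0 k y) = extD (C.form 1 i) y (C.frame 1 j y) (C.frame 0 k y) := by
  fin_cases k <;> simp [conn, C.form_frame hy]

lemma conn_frame_one (hy : y ∈ C.chart.target) (j i k : Fin 2) :
    C.conn j i y (C.frame 1 k y) = extD (C.form 0 i) y (C.frame 0 j y) (C.frame 1 k y) := by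
  fin_cases k <;> simp [conn, C.form_frame hy]

lemma extD_form_zero_frame_one (hy : y ∈ C.chart.target) (i j k : Fin 2) :
    extD (C.form 0 i) y (C.frame 1 j y) (C.frame 1 k y) = 0 :=
  C.extD_distForm 0 i hy (C.contDiffOn_frame 1 j) (C.contDiffOn_frame 1 k)
    (fun z hz l => by simp [distForm, C.form_frame hz])
    (fun z hz l => by simp [distForm, C.form_frame hz])

lemma extD_form_one_frame_zero (hy : y ∈ C.chart.target) (i j k : Fin 2) :
    extD (C.form 1 i) y (C.frame 0 j y) (C.frame 0 k y) = 0 :=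
  C.extD_distForm 1 i hy (C.contDiffOn_frame 0 j) (C.contDiffOn_frame 0 k)
    (fun z hz l => by simp [distForm, C.form_frame hz])
    (fun z hz l => by simp [distForm, C.form_frame hz])

lemma extD_distForm_two (hy : y ∈ C.chart.target) (i : Fin 2) (u v : R4) :
    extD (C.distForm 2 i) y u v = -(extD (C.form 0 i) y u v + extD (C.form 1 i) y u v) := by
  have hd (α : Fin 2) := differentiableAt_of_contDiffOn C.chart.open_target (C.smooth α i) hy
  have hf : fderiv ℝ (C.distForm 2 i) y = -(fderiv ℝ (C.form 0 i) y + fderiv ℝ (C.form 1 i) y) := by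
    change fderiv ℝ (fun z => -(C.form 0 i z + C.form 1 i z)) y = _
    rw [fderiv_fun_neg, fderiv_fun_add (hd 0) (hd 1)]
  simp only [extD, hf, neg_apply, add_apply]
  ring

lemma extD_form_add_extD_form (hy : y ∈ C.chart.target) (i j k : Fin 2) :
    extD (C.form 0 i) y (C.frame 0 j y - C.frame 1 j y) (C.frame 0 k y - C.frame 1 k y)
      + extD (C.form 1 i) y (C.frame 0 j y - C.frame 1 j y) (C.frame 0 k y - C.frame 1 k y)
      = 0 := by
  rw [← neg_eq_zero, ← C.extD_distForm_two hy]
  exact C.extD_distForm 2 i hy ((C.contDiffOn_frame 0 j).sub (C.contDiffOn_frame 1 j))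
    ((C.contDiffOn_frame 0 k).sub (C.contDiffOn_frame 1 k))
    (fun z hz l => by simp [distForm, C.form_frame hz])
    (fun z hz l => by simp [distForm, C.form_frame hz])

lemma a_eq_sum (hy : y ∈ C.chart.target) (j : Fin 2) :
    C.a j y = ∑ k, (extD (C.form 0 k) y (C.frame 0 j y) (C.frame 0 k y)
      - C.conn j k y (C.frame 0 k y) + C.conn k k y (C.frame 0 j y)) := by
  refine Finset.sum_congr rfl fun k _ => ?_
  simp only [wedge, C.form_frame hy, true_and, ite_mul, one_mul, zero_mul,
    Finset.sum_sub_distrib, Finset.sum_ite_eq, Finset.mem_univ, if_true]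
  ring

lemma extD_form_zero_frame_zero (hy : y ∈ C.chart.target) (i k l : Fin 2) :
    extD (C.form 0 i) y (C.frame 0 k y) (C.frame 0 l y) =
      C.conn k i y (C.frame 0 l y) - C.conn l i y (C.frame 0 k y)
        + (if l = i then C.a k y else 0) - (if k = i then C.a l y else 0) := by
  have hself (i k : Fin 2) : extD (C.form 0 i) y (C.frame 0 k y) (C.frame 0 k y) = 0 :=
    sub_self _
  have hswap (i : Fin 2) := extD_swap (C.form 0 i) y (C.frame 0 1 y) (C.frame 0 0 y)
  simp only [C.a_eq_sum hy, Fin.sum_univ_two]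
  fin_cases i <;> fin_cases k <;> fin_cases l <;> simp [hself, hswap] <;> ring

lemma extD_form_one_frame_one (hy : y ∈ C.chart.target) (i k l : Fin 2) :
    extD (C.form 1 i) y (C.frame 1 k y) (C.frame 1 l y) =
      C.conn k i y (C.frame 1 l y) - C.conn l i y (C.frame 1 k y)
        - (if l = i then C.a k y else 0) + (if k = i then C.a l y else 0) := by
  have h := C.extD_form_add_extD_form hy i k l
  simp only [extD_sub_sub, C.extD_form_zero_frame_zero hy, C.extD_form_zero_frame_one hy,
    C.extD_form_one_frame_zero hy, ← C.conn_frame_one hy, ← C.conn_frame_zero hy,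
    extD_swap (C.form 0 i) y (C.frame 1 k y) (C.frame 0 l y),
    extD_swap (C.form 1 i) y (C.frame 0 k y) (C.frame 1 l y)] at h
  linear_combination h

/-- The frame dual to the coframe, with both halves indexed together as in a `WebFrame`. -/
def vec : Fin 2 ⊕ Fin 2 → R4 → R4 := Sum.elim (C.frame 0) (C.frame 1)

/-- The coframe, with both halves indexed together as in a `WebFrame`. -/
def covec : Fin 2 ⊕ Fin 2 → R4 → R4 →L[ℝ] ℝ := Sum.elim (C.form 0) (C.form 1)

lemma contDiffOn_vec (r : Fin 2 ⊕ Fin 2) : ContDiffOn ℝ ∞ (C.vec r) C.chart.target := by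
  rcases r with k | k
  · exact C.contDiffOn_frame 0 k
  · exact C.contDiffOn_frame 1 k

lemma contDiffOn_covec (r : Fin 2 ⊕ Fin 2) : ContDiffOn ℝ ∞ (C.covec r) C.chart.target := by
  rcases r with k | k
  · exact C.smooth 0 k
  · exact C.smooth 1 k

lemma covec_vec (hy : y ∈ C.chart.target) (r s : Fin 2 ⊕ Fin 2) :
    C.covec r y (C.vec s y) = if r = s then 1 else 0 := by
  rcases r with k | k <;> rcases s with l | l <;>
    simp [covec, vec, C.form_frame hy, eq_comm]

lemma eq_sum_vec (hy : y ∈ C.chart.target) (v : R4) :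
    v = ∑ t, C.covec t y v • C.vec t y := by
  rw [← sub_eq_zero]
  have h (t : Fin 2 ⊕ Fin 2) : C.covec t y (v - ∑ t, C.covec t y v • C.vec t y) = 0 := by
    simp only [map_sub, map_sum, map_smul, smul_eq_mul, C.covec_vec hy, mul_ite, mul_one,
      mul_zero, Finset.sum_ite_eq, Finset.mem_univ, if_true, sub_self]
  refine C.eq_zero_of_forms_eq_zero hy fun α i => ?_
  fin_cases α
  · exact h (.inl i)
  · exact h (.inr i)

/-- The structure functions of the frame, as determined by the structure equations. -/
def structureFun (r s t : Fin 2 ⊕ Fin 2) (y : R4) : ℝ :=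
  frameConn (fun j i r => C.conn j i y (C.vec r y)) s t r
    - frameConn (fun j i r => C.conn j i y (C.vec r y)) r t s
    + webTorsion (fun j => C.a j y) r s t

lemma covec_lieBracket (hy : y ∈ C.chart.target) (r s t : Fin 2 ⊕ Fin 2) :
    C.covec t y (VectorField.lieBracket ℝ (C.vec r) (C.vec s) y) = C.structureFun r s t y := by
  have hU := C.chart.open_target
  have hconst (r : Fin 2 ⊕ Fin 2) :
      ∀ᶠ z in 𝓝 y, C.covec t z (C.vec r z) = if t = r then 1 else 0 := by
    filter_upwards [hU.mem_nhds hy] with z hz using C.covec_vec hz t r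
  have h := extD_eq_neg_apply_lieBracket
    (differentiableAt_of_contDiffOn hU (C.contDiffOn_covec t) hy)
    (differentiableAt_of_contDiffOn hU (C.contDiffOn_vec r) hy)
    (differentiableAt_of_contDiffOn hU (C.contDiffOn_vec s) hy) (hconst r) (hconst s)
  rw [← neg_eq_iff_eq_neg.2 h]
  rcases r with r | r <;> rcases s with s | s <;> rcases t with t | t <;>
    simp only [covec, vec, Sum.elim_inl, Sum.elim_inr, structureFun, frameConn, webTorsion,
      C.extD_form_zero_frame_zero hy, C.extD_form_zero_frame_one hy,
      C.extD_form_one_frame_zero hy, C.extD_form_one_frame_one hy, ← C.conn_frame_one hy,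
      ← C.conn_frame_zero hy, extD_swap (C.form 0 t) y (C.frame 1 r y) (C.frame 0 s y),
      extD_swap (C.form 1 t) y (C.frame 0 r y) (C.frame 1 s y), Pi.zero_apply] <;> ring

end ThreeWeb.AdaptedCoframe

end Coframe

section CoframeRing

open TopologicalSpace

lemma map_frameConn {A B n ι : Type*} [CommRing A] [CommRing B] (φ : A →+* B)
    (w : n → n → ι → A) (r s : n ⊕ n) (i : ι) :
    φ (frameConn w r s i) = frameConn (fun j k i => φ (w j k i)) r s i := by
  rcases r with r | r <;> rcases s with s | s <;> simp [frameConn]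

lemma map_webTorsion {A B n : Type*} [CommRing A] [CommRing B] [DecidableEq n] (φ : A →+* B)
    (a : n → A) (r s t : n ⊕ n) :
    φ (webTorsion a r s t) = webTorsion (fun j => φ (a j)) r s t := by
  rcases r with r | r <;> rcases s with s | s <;> rcases t with t | t <;>
    simp [webTorsion, apply_ite φ]

namespace ThreeWeb.AdaptedCoframe

open smoothFunctions

variable {M : Type*} [TopologicalSpace M] [ChartedSpace R4 M] {W : ThreeWeb M}
  (C : W.AdaptedCoframe) (V : Opens R4) (hV : (V : Set R4) ⊆ C.chart.target)

/-- The components of a one-form in the frame of the web, as smooth functions. -/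
def components (θ : R4 → R4 →L[ℝ] ℝ) (hθ : ContDiffOn ℝ ∞ θ C.chart.target)
    (r : Fin 2 ⊕ Fin 2) : smoothFunctions V :=
  smoothFunctions.mk (fun y => θ y (C.vec r y)) ((hθ.clm_apply (C.contDiffOn_vec r)).mono hV)

/-- The web frame of an adapted coframe, on an open part of the coordinate domain. -/
def webFrame : WebFrame ℝ (smoothFunctions V) (Fin 2) where
  e r := vectorField (C.vec r) ((C.contDiffOn_vec r).mono hV)
  w j i := C.components V hV (C.conn j i) (C.contDiffOn_conn j i)
  a j := smoothFunctions.mk (C.a j) ((C.contDiffOn_a j).mono hV)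
  c r s t := frameConn (fun j i => C.components V hV (C.conn j i) (C.contDiffOn_conn j i)) s t r
    - frameConn (fun j i => C.components V hV (C.conn j i) (C.contDiffOn_conn j i)) r t s
    + webTorsion (fun j => smoothFunctions.mk (C.a j) ((C.contDiffOn_a j).mono hV)) r s t
  c_eq _ _ _ := rfl
  lie_e r s := by
    rw [bracket_vectorField]
    refine vectorField_eq_sum _ _ fun y => ?_
    refine (C.eq_sum_vec (hV y.2) _).trans (Finset.sum_congr rfl fun t _ => ?_)
    rw [C.covec_lieBracket (hV y.2), map_add, map_sub, map_frameConn, map_frameConn,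
      map_webTorsion]
    rfl
  independent f h k := linearIndependent_vectorField
    (fun r => (C.contDiffOn_vec r).mono hV)
    (fun y hy r s => C.covec_vec (hV hy) r s) f h k

variable {V}

lemma eval_webFrame_c (r s t : Fin 2 ⊕ Fin 2) (y : V) :
    eval y ((C.webFrame V hV).c r s t) = C.structureFun r s t y := by
  rw [WebFrame.c_eq, map_add, map_sub, map_frameConn, map_frameConn, map_webTorsion]
  rfl

lemma eval_extDeriv_components {θ : R4 → R4 →L[ℝ] ℝ} (hθ : ContDiffOn ℝ ∞ θ C.chart.target)
    (r s : Fin 2 ⊕ Fin 2) (y : V) :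
    eval y ((C.webFrame V hV).extDeriv (C.components V hV θ hθ) r s) =
      extD θ y (C.vec r y) (C.vec s y) := by
  have hU := C.chart.open_target
  have hy := hV y.2
  rw [extD_eq_lieBracket (differentiableAt_of_contDiffOn hU hθ hy)
    (differentiableAt_of_contDiffOn hU (C.contDiffOn_vec r) hy)
    (differentiableAt_of_contDiffOn hU (C.contDiffOn_vec s) hy),
    C.eq_sum_vec hy (VectorField.lieBracket ℝ (C.vec r) (C.vec s) y),
    MovingFrame.extDeriv_apply]
  simp only [map_sub, map_sum, map_mul, map_smul, smul_eq_mul, eval_webFrame_c,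
    C.covec_lieBracket hy]
  simp only [webFrame, components, eval_vectorField_mk, eval_mk]

lemma eval_webFrame_b (i j k l : Fin 2) (y : V) :
    eval y ((C.webFrame V hV).b i j k l) = C.b i j k l y := by
  have h : (C.webFrame V hV).b i j k l = (C.webFrame V hV).extDeriv
      (C.components V hV (C.conn j i) (C.contDiffOn_conn j i)) (.inl k) (.inr l)
      - ∑ m, MovingFrame.wedge ((C.webFrame V hV).w j m) ((C.webFrame V hV).w m i)
          (.inl k) (.inr l) := by
    simp only [WebFrame.b, WebFrame.curv, MovingFrame.curvature, Pi.sub_apply, Finset.sum_apply]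
    rfl
  rw [h, map_sub, eval_extDeriv_components, map_sum]
  simp only [MovingFrame.wedge, map_sub, map_mul]
  rfl

lemma eval_webFrame_covA_inl (i j : Fin 2) (y : V) :
    eval y ((C.webFrame V hV).covA i (.inl j)) = C.p i j y := by
  simp only [WebFrame.covA, MovingFrame.covDeriv, map_sub, map_sum, map_mul]
  simp only [webFrame, components, eval_vectorField_mk, eval_mk]
  rfl

lemma eval_webFrame_covA_inr (i j : Fin 2) (y : V) :
    eval y ((C.webFrame V hV).covA i (.inr j)) = C.q i j y := by
  simp only [WebFrame.covA, MovingFrame.covDeriv, map_sub, map_sum, map_mul]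
  simp only [webFrame, components, eval_vectorField_mk, eval_mk]
  rfl

end ThreeWeb.AdaptedCoframe

end CoframeRing

section Relabelling

variable {A n : Type*} (σ : Equiv.Perm n)

lemma frameConn_relabel {E : Type*} [Zero E] (w : n → n → E) (r s : n ⊕ n) :
    frameConn w (Sum.map σ σ r) (Sum.map σ σ s) = frameConn (fun j i => w (σ j) (σ i)) r s := by
  rcases r with r | r <;> rcases s with s | s <;> rfl

lemma webTorsion_relabel [CommRing A] [DecidableEq n] (a : n → A) (r s t : n ⊕ n) :
    webTorsion a (Sum.map σ σ r) (Sum.map σ σ s) (Sum.map σ σ t) =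
      webTorsion (fun j => a (σ j)) r s t := by
  rcases r with r | r <;> rcases s with s | s <;> rcases t with t | t <;> simp [webTorsion]

namespace WebFrame

variable {R : Type*} [CommRing R] [CommRing A] [Algebra R A] [Fintype n] [DecidableEq n]
  (W : WebFrame R A n)

/-- The web frame in which the indices of the coframe are renamed by a permutation. -/
def relabel : WebFrame R A n where
  e r := W.e (Sum.map σ σ r)
  c r s t := W.c (Sum.map σ σ r) (Sum.map σ σ s) (Sum.map σ σ t)
  w j i r := W.w (σ j) (σ i) (Sum.map σ σ r)
  a j := W.a (σ j)
  c_eq r s t := by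
    rw [W.c_eq, frameConn_relabel, frameConn_relabel, webTorsion_relabel]
    rcases r with r | r <;> rcases s with s | s <;> rcases t with t | t <;> rfl
  lie_e r s := (W.lie_e _ _).trans ((Equiv.sumCongr σ σ).sum_comp
    (fun k => W.c (Sum.map σ σ r) (Sum.map σ σ s) k • W.e k)).symm
  independent f h k := by
    have h' : ∑ k, f ((Equiv.sumCongr σ σ).symm k) • W.e k = 0 := by
      rw [← h, ← (Equiv.sumCongr σ σ).sum_comp]
      exact Finset.sum_congr rfl fun k _ => by rw [Equiv.symm_apply_apply]; rfl
    simpa using W.independent _ h' (Equiv.sumCongr σ σ k)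

lemma relabel_extDeriv (φ : n ⊕ n → A) (r s : n ⊕ n) :
    (W.relabel σ).extDeriv (fun r => φ (Sum.map σ σ r)) r s =
      W.extDeriv φ (Sum.map σ σ r) (Sum.map σ σ s) := by
  simp only [MovingFrame.extDeriv_apply]
  exact congrArg _ ((Equiv.sumCongr σ σ).sum_comp
    (fun k => W.c (Sum.map σ σ r) (Sum.map σ σ s) k * φ k))

lemma relabel_b (i j k l : n) : (W.relabel σ).b i j k l = W.b (σ i) (σ j) (σ k) (σ l) := by
  simp only [b, curv, MovingFrame.curvature, Pi.sub_apply, Finset.sum_apply]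
  exact congrArg₂ _ (W.relabel_extDeriv σ (W.w (σ j) (σ i)) (.inl k) (.inr l))
    (Equiv.sum_comp σ fun m =>
      MovingFrame.wedge (W.w (σ j) m) (W.w m (σ i)) (.inl (σ k)) (.inr (σ l)))

lemma relabel_covA (i : n) (r : n ⊕ n) :
    (W.relabel σ).covA i r = W.covA (σ i) (Sum.map σ σ r) :=
  congrArg _ (Equiv.sum_comp σ fun m => W.a m * W.w (σ i) m (Sum.map σ σ r))

end WebFrame

end Relabelling

section GeodesicSurfaces

open TopologicalSpace

lemma MovingFrame.sum_smul_curvature_eq_neg {R A ι κ : Type*} [CommRing R] [CommRing A]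
    [Algebra R A] [Fintype ι] [Fintype κ] (M : MovingFrame R A ι) {Θ : κ → κ → ι → A} {f : κ → A}
    {φ : ι → A} (h : ∀ x, M.covDeriv Θ f x = f x • φ) (x : κ) :
    ∑ y, f y • M.curvature Θ x y = -(f x • M.extDeriv φ) := by
  have hd := M.extDeriv_covDeriv Θ f x
  rw [h, M.extDeriv_smul, eq_sub_iff_add_eq] at hd
  have hwedge : (M.e · (f x)) ⋏ φ = ∑ y, Θ x y ⋏ M.covDeriv Θ f y := by
    ext i j
    simp only [h, wedge, Pi.smul_apply, smul_eq_mul, Finset.sum_apply,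
      M.e_eq_sum_add_covDeriv Θ f x, add_mul, Finset.sum_mul, Finset.sum_sub_distrib]
    have hcomm (i j : ι) : ∑ y, f y * Θ x y i * φ j = ∑ y, Θ x y i * (f y * φ j) :=
      Finset.sum_congr rfl fun y _ => by ring
    rw [hcomm i j, hcomm j i]
    ring
  rw [hwedge] at hd
  linear_combination (exp := 1) hd

lemma eq_sum_smul_of_dual {E ι : Type*} [AddCommGroup E] [Module ℝ E] [FiniteDimensional ℝ E]
    [Fintype ι] [DecidableEq ι] (hdim : Fintype.card ι = Module.finrank ℝ E) {φ : ι → E →ₗ[ℝ] ℝ}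
    {e : ι → E}
    (h : ∀ i j, φ i (e j) = if i = j then 1 else 0) (w : E) : w = ∑ i, φ i w • e i := by
  have hφ (c : ι → ℝ) (i : ι) : φ i (∑ j, c j • e j) = c i := by
    simp [h]
  have hli : LinearIndependent ℝ e := Fintype.linearIndependent_iff.2 fun c hc i => by
    rw [← hφ c i, hc, map_zero]
  have hw : w ∈ Submodule.span ℝ (Set.range e) :=
    hli.span_eq_top_of_card_eq_finrank' hdim ▸ Submodule.mem_top
  obtain ⟨c, rfl⟩ := (Submodule.mem_span_range_iff_exists_fun ℝ).1 hw
  simp only [hφ]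

namespace ThreeWeb

lemma extD_pullback {θ : R4 → R4 →L[ℝ] ℝ} {S : R2 → R4} {e f : R2 → R2} {t : R2}
    (hθ : DifferentiableAt ℝ θ (S t)) (hS : ContDiffAt ℝ ∞ S t) (he : DifferentiableAt ℝ e t)
    (hf : DifferentiableAt ℝ f t) :
    extD θ (S t) (fderiv ℝ S t (e t)) (fderiv ℝ S t (f t)) =
      fderiv ℝ (fun z => θ (S z) (fderiv ℝ S z (f z))) t (e t)
      - fderiv ℝ (fun z => θ (S z) (fderiv ℝ S z (e z))) t (f t)
      - θ (S t) (fderiv ℝ S t (VectorField.lieBracket ℝ e f t)) := by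
  have hdS : DifferentiableAt ℝ (fderiv ℝ S) t :=
    (hS.fderiv_right (m := ∞) (by simp)).differentiableAt (by simp)
  have hSd : DifferentiableAt ℝ S t := hS.differentiableAt (by simp)
  have hθSd : DifferentiableAt ℝ (fun z => θ (S z)) t := hθ.comp t hSd
  have hθS : fderiv ℝ (fun z => θ (S z)) t = (fderiv ℝ θ (S t)).comp (fderiv ℝ S t) :=
    fderiv_comp t hθ hSd
  have leibniz {f : R2 → R2} (hf : DifferentiableAt ℝ f t) (v : R2) :
      fderiv ℝ (fun z => θ (S z) (fderiv ℝ S z (f z))) t v =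
        fderiv ℝ θ (S t) (fderiv ℝ S t v) (fderiv ℝ S t (f t))
          + θ (S t) (fderiv ℝ (fderiv ℝ S) t v (f t))
          + θ (S t) (fderiv ℝ S t (fderiv ℝ f t v)) := by
    rw [fderiv_clm_apply hθSd (hdS.clm_apply hf), fderiv_clm_apply hdS hf, hθS]
    simp only [ContinuousLinearMap.comp_add, add_apply, ContinuousLinearMap.comp_apply,
      ContinuousLinearMap.flip_apply]
    ring
  rw [leibniz hf, leibniz he, isSymmSndFDerivAt_of_contDiffAt hS (f t) (e t)]
  simp only [extD, VectorField.lieBracket, map_sub]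
  ring

lemma extD_sum_smul (θ : R4 → R4 →L[ℝ] ℝ) (y : R4) (a : Fin 2 → ℝ) (u v : Fin 2 → R4) :
    extD θ y (∑ k, a k • u k) (∑ l, a l • v l) =
      ∑ k, ∑ l, a k * a l * extD θ y (u k) (v l) := by
  simp only [extD, Fin.sum_univ_two, map_add, map_smul, add_apply, smul_apply, smul_eq_mul]
  ring

namespace AdaptedCoframe

variable {M : Type*} [TopologicalSpace M] [ChartedSpace R4 M] {W : ThreeWeb M}
  (C : W.AdaptedCoframe)

/-- The coordinate expression of a transversally geodesic surface: the values of `ω₁ⁱ` and of `ω₂ⁱ`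
on its tangent vectors are proportional to a common direction. -/
structure IsGeodesicSurface (N : Set R2) (S : R2 → R4) : Prop where
  isOpen : IsOpen N
  smooth : ContDiffOn ℝ ∞ S N
  mapsTo : ∀ t ∈ N, S t ∈ C.chart.target
  exists_direction : ∀ t ∈ N, ∃ ξ : Fin 2 → ℝ, ∀ α v, ∃ s : ℝ, ∀ i,
    C.form α i (S t) (fderiv ℝ S t v) = s * ξ i

/-- Vector fields on a transversally geodesic surface, tangent to the lines which the first two
foliations cut on it, with the common direction `ζ` normalized by `ζ j = 1`. -/
structure SurfaceFrame (S : R2 → R4) (U : Opens R2) (j : Fin 2) where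
  e : Fin 2 → R2 → R2
  ζ : Fin 2 → R2 → ℝ
  smooth : ContDiffOn ℝ ∞ S U
  mapsTo : ∀ t ∈ U, S t ∈ C.chart.target
  smooth_e : ∀ α, ContDiffOn ℝ ∞ (e α) U
  smooth_ζ : ∀ i, ContDiffOn ℝ ∞ (ζ i) U
  ζ_eq_one : ∀ t ∈ U, ζ j t = 1
  form_e : ∀ t ∈ U, ∀ α β i,
    C.form α i (S t) (fderiv ℝ S t (e β t)) = if α = β then ζ i t else 0

variable {C} {S : R2 → R4}

lemma contDiffOn_form_fderiv {U : Set R2} (hU : IsOpen U) (hS : ContDiffOn ℝ ∞ S U)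
    {T : Set R4} (hmaps : ∀ t ∈ U, S t ∈ T) {θ : R4 → R4 →L[ℝ] ℝ} (hθ : ContDiffOn ℝ ∞ θ T)
    {e : R2 → R2} (he : ContDiffOn ℝ ∞ e U) :
    ContDiffOn ℝ ∞ (fun t => θ (S t) (fderiv ℝ S t (e t))) U :=
  (hθ.comp hS hmaps).clm_apply (contDiffOn_fderiv_apply hU hS he)

namespace SurfaceFrame

open smoothFunctions

variable {U : Opens R2} {j : Fin 2} (G : C.SurfaceFrame S U j)

include G in
lemma contDiffOn_pullback {θ : R4 → R4 →L[ℝ] ℝ} (hθ : ContDiffOn ℝ ∞ θ C.chart.target)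
    {e : R2 → R2} (he : ContDiffOn ℝ ∞ e U) :
    ContDiffOn ℝ ∞ (fun t => θ (S t) (fderiv ℝ S t (e t))) U :=
  contDiffOn_form_fderiv U.isOpen G.smooth G.mapsTo hθ he

lemma form_e_eq_ite {t : R2} (ht : t ∈ U) (α β : Fin 2) :
    C.form α j (S t) (fderiv ℝ S t (G.e β t)) = if α = β then 1 else 0 := by
  rw [G.form_e t ht, G.ζ_eq_one t ht]

lemma eq_sum_e {t : R2} (ht : t ∈ U) (w : R2) :
    w = ∑ α, C.form α j (S t) (fderiv ℝ S t w) • G.e α t :=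
  eq_sum_smul_of_dual (by simp)
    (φ := fun α => ((C.form α j (S t)).comp (fderiv ℝ S t)).toLinearMap)
    (G.form_e_eq_ite ht) w

lemma fderiv_e {t : R2} (ht : t ∈ U) (β : Fin 2) :
    fderiv ℝ S t (G.e β t) = ∑ k, G.ζ k t • C.frame β k (S t) := by
  rw [C.eq_sum_vec (G.mapsTo t ht) (fderiv ℝ S t (G.e β t))]
  have h (α i : Fin 2) := G.form_e t ht α β i
  rcases Fin.exists_fin_two.1 ⟨β, rfl⟩ with rfl | rfl <;>
    simp [Fintype.sum_sum_type, covec, vec, h]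

/-- The fields of a surface frame, as a moving frame on the ring of functions of the surface. -/
def movingFrame : MovingFrame ℝ (smoothFunctions U) (Fin 2) where
  e α := vectorField (G.e α) (G.smooth_e α)
  c α β γ := smoothFunctions.mk _ (G.contDiffOn_pullback (C.smooth γ j)
    (contDiffOn_lieBracket U.isOpen (G.smooth_e α) (G.smooth_e β)))
  lie_e α β := by
    rw [bracket_vectorField]
    exact vectorField_eq_sum _ _ fun t => G.eq_sum_e t.2 _
  independent f h k := linearIndependent_vectorField G.smooth_e
    (θ := fun α t => (C.form α j (S t)).comp (fderiv ℝ S t))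
    (fun _ ht α β => G.form_e_eq_ite ht α β) f h k

/-- The components of the pull-back of a one-form to the surface. -/
def pullback (θ : R4 → R4 →L[ℝ] ℝ) (hθ : ContDiffOn ℝ ∞ θ C.chart.target) (α : Fin 2) :
    smoothFunctions U :=
  smoothFunctions.mk _ (G.contDiffOn_pullback hθ (G.smooth_e α))

/-- The direction of the surface as a pair of smooth functions. -/
def direction (i : Fin 2) : smoothFunctions U := smoothFunctions.mk (G.ζ i) (G.smooth_ζ i)

lemma eval_pullback {θ : R4 → R4 →L[ℝ] ℝ} (hθ : ContDiffOn ℝ ∞ θ C.chart.target) (α : Fin 2)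
    (t : U) : eval t (G.pullback θ hθ α) = ∑ k, G.ζ k t * θ (S t) (C.frame α k (S t)) := by
  rw [pullback, eval_mk, G.fderiv_e t.2, map_sum]
  simp only [map_smul, smul_eq_mul]

lemma pullback_form (α i β : Fin 2) :
    G.pullback (C.form α i) (C.smooth α i) β = if α = β then G.direction i else 0 := by
  refine ext_eval fun t => (G.form_e t t.2 α β i).trans ?_
  rw [apply_ite (eval t), map_zero]
  rfl

lemma eval_extDeriv_pullback {θ : R4 → R4 →L[ℝ] ℝ} (hθ : ContDiffOn ℝ ∞ θ C.chart.target)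
    (α β : Fin 2) (t : U) : eval t (G.movingFrame.extDeriv (G.pullback θ hθ) α β) =
      ∑ k, ∑ l, G.ζ k t * G.ζ l t * extD θ (S t) (C.frame α k (S t)) (C.frame β l (S t)) := by
  have ht := t.2
  rw [← extD_sum_smul, ← G.fderiv_e ht, ← G.fderiv_e ht, extD_pullback
    (differentiableAt_of_contDiffOn C.chart.open_target hθ (G.mapsTo t ht))
    (G.smooth.contDiffAt (U.isOpen.mem_nhds ht))
    (differentiableAt_of_contDiffOn U.isOpen (G.smooth_e α) ht)
    (differentiableAt_of_contDiffOn U.isOpen (G.smooth_e β) ht),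
    G.eq_sum_e ht (VectorField.lieBracket ℝ (G.e α) (G.e β) t), MovingFrame.extDeriv_apply]
  simp only [map_sub, map_sum, map_mul, map_smul, smul_eq_mul]
  simp only [movingFrame, pullback, eval_vectorField_mk, eval_mk]

/-- The connection of the web along the surface, dual to the forms `ω_jⁱ`, so that it acts on the
direction of the surface. -/
def conn (m k : Fin 2) : Fin 2 → smoothFunctions U :=
  -G.pullback (C.conn k m) (C.contDiffOn_conn k m)

lemma extDeriv_pullback_form_zero (m : Fin 2) :
    G.movingFrame.extDeriv (G.pullback (C.form 0 m) (C.smooth 0 m)) 0 1 =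
      -∑ k, G.direction k * G.conn m k 1 := by
  refine ext_eval fun t => ?_
  have hframe := C.conn_frame_one (G.mapsTo t t.2)
  simp only [eval_extDeriv_pullback, ← hframe, map_neg, map_add, map_mul, conn, Pi.neg_apply,
    eval_pullback, direction, eval_mk, Fin.sum_univ_two]
  ring

lemma extDeriv_pullback_form_one (m : Fin 2) :
    G.movingFrame.extDeriv (G.pullback (C.form 1 m) (C.smooth 1 m)) 0 1 =
      ∑ k, G.direction k * G.conn m k 0 := by
  refine ext_eval fun t => ?_
  have hframe := C.conn_frame_zero (G.mapsTo t t.2)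
  simp only [eval_extDeriv_pullback, extD_swap _ _ (C.frame 0 _ _), ← hframe, map_neg, map_add,
    map_mul, conn, Pi.neg_apply, eval_pullback, direction, eval_mk, Fin.sum_univ_two]
  ring

lemma covDeriv_direction (m : Fin 2) : G.movingFrame.covDeriv G.conn G.direction m =
    G.direction m • ![G.movingFrame.c 0 1 1, -G.movingFrame.c 0 1 0] := by
  have h₀ := G.extDeriv_pullback_form_zero m
  have h₁ := G.extDeriv_pullback_form_one m
  simp only [MovingFrame.extDeriv_apply, pullback_form, zero_ne_one, ↓reduceIte, map_zero, zero_sub,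
    mul_ite, mul_zero, Finset.sum_ite_eq, Finset.mem_univ, Fin.sum_univ_two, neg_add_rev,
    one_ne_zero, sub_zero] at h₀ h₁
  refine funext (Fin.forall_fin_two.2 ⟨?_, ?_⟩) <;>
    simp only [MovingFrame.covDeriv, Fin.sum_univ_two, Pi.smul_apply, Matrix.cons_val_zero,
      Matrix.cons_val_one, smul_eq_mul]
  · linear_combination h₁
  · linear_combination -h₀

lemma eval_curvature_conn (m k : Fin 2) (t : U) :
    eval t (G.movingFrame.curvature G.conn m k 0 1) =
      -∑ l, ∑ n, C.b m k l n (S t) * G.ζ l t * G.ζ n t := by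
  simp only [MovingFrame.curvature, MovingFrame.wedge, conn, map_neg, Pi.sub_apply, Pi.neg_apply,
    Pi.add_apply, map_add, map_sub, map_mul, eval_extDeriv_pullback, eval_pullback, b,
    ThreeWeb.wedge, Fin.sum_univ_two]
  ring

lemma exists_b_eq (t : U) : ∃ c : ℝ, ∀ m,
    ∑ k, ∑ l, ∑ n, C.b m k l n (S t) * G.ζ k t * G.ζ l t * G.ζ n t = c * G.ζ m t := by
  have h := G.movingFrame.sum_smul_curvature_eq_neg G.covDeriv_direction
  refine ⟨eval t (G.movingFrame.extDeriv ![G.movingFrame.c 0 1 1, -G.movingFrame.c 0 1 0] 0 1),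
    fun m => ?_⟩
  have hm := congrArg (eval t) (congrFun₂ (h m) 0 1)
  simp only [Finset.sum_apply, Pi.smul_apply, Pi.neg_apply, smul_eq_mul, map_add, map_mul, map_neg,
    eval_curvature_conn, direction, eval_mk, Fin.sum_univ_two] at hm ⊢
  linear_combination -hm

end SurfaceFrame

/-- The forms `ω₁ʲ` and `ω₂ʲ`, pulled back to a surface, as a map on its tangent vectors. -/
def surfaceCoframeMap (C : W.AdaptedCoframe) (S : R2 → R4) (j : Fin 2) (t : R2) :
    R2 →L[ℝ] (Fin 2 → ℝ) :=
  ContinuousLinearMap.pi fun α => (C.form α j (S t)).comp (fderiv ℝ S t)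

namespace IsGeodesicSurface

variable {N : Set R2} (hN : C.IsGeodesicSurface N S)
include hN

lemma contDiffOn_surfaceCoframeMap (j : Fin 2) : ContDiffOn ℝ ∞ (C.surfaceCoframeMap S j) N :=
  contDiffOn_clm_apply.2 fun _ => contDiffOn_pi.2 fun α =>
    contDiffOn_form_fderiv hN.isOpen hN.smooth hN.mapsTo (C.smooth α j) contDiffOn_const

lemma form_eq_zero_or_eq {t : R2} (ht : t ∈ N) {j : Fin 2} {e : Fin 2 → R2}
    (h : ∀ α β, C.form α j (S t) (fderiv ℝ S t (e β)) = if α = β then 1 else 0) (α β i : Fin 2) :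
    C.form α i (S t) (fderiv ℝ S t (e β)) =
      if α = β then C.form 0 i (S t) (fderiv ℝ S t (e 0)) else 0 := by
  obtain ⟨ξ, hξ⟩ := hN.exists_direction t ht
  choose s hs using hξ
  have hsξ (α β : Fin 2) : s α (e β) * ξ j = if α = β then 1 else 0 := by rw [← hs, h]
  have hξj : ξ j ≠ 0 := right_ne_zero_of_mul ((hsξ 0 0).trans_ne (by simp))
  have hs_eq : s α (e β) = if α = β then s 0 (e 0) else 0 := mul_right_cancel₀ hξj (by
    rw [hsξ, ite_mul, hsξ, zero_mul, if_pos rfl])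
  rw [hs, hs, hs_eq, ite_mul, zero_mul]

lemma exists_surfaceFrame (h0 : (0 : R2) ∈ N) {j : Fin 2}
    (hinv : (C.surfaceCoframeMap S j 0).IsInvertible) :
    ∃ (U : Opens R2) (_ : C.SurfaceFrame S U j), (0 : R2) ∈ U := by
  have hL := hN.contDiffOn_surfaceCoframeMap j
  let U : Opens R2 :=
    ⟨N ∩ C.surfaceCoframeMap S j ⁻¹' Set.range ((↑) : (R2 ≃L[ℝ] (Fin 2 → ℝ)) → _),
      hL.continuousOn.isOpen_inter_preimage hN.isOpen ContinuousLinearEquiv.isOpen⟩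
  have hUN : (U : Set R2) ⊆ N := Set.inter_subset_left
  have hU (t : R2) (ht : t ∈ U) : (C.surfaceCoframeMap S j t).IsInvertible := ht.2
  let e (β : Fin 2) (t : R2) : R2 := (C.surfaceCoframeMap S j t).inverse (Pi.single β 1)
  have he (β : Fin 2) : ContDiffOn ℝ ∞ (e β) U := fun t ht =>
    ((hU t ht).contDiffAt_map_inverse.comp_contDiffWithinAt t
      (hL.mono hUN t ht)).clm_apply contDiffWithinAt_const
  have hform_e (t : R2) (ht : t ∈ U) (α β : Fin 2) :
      C.form α j (S t) (fderiv ℝ S t (e β t)) = if α = β then 1 else 0 :=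
    (congrFun ((hU t ht).self_apply_inverse _) α).trans (Pi.single_apply β 1 α)
  exact ⟨U, {
    e := e
    ζ := fun i t => C.form 0 i (S t) (fderiv ℝ S t (e 0 t))
    smooth := hN.smooth.mono hUN
    mapsTo := fun t ht => hN.mapsTo t (hUN ht)
    smooth_e := he
    smooth_ζ := fun i => contDiffOn_form_fderiv U.isOpen (hN.smooth.mono hUN)
      (fun t ht => hN.mapsTo t (hUN ht)) (C.smooth 0 i) (he 0)
    ζ_eq_one := fun t ht => hform_e t ht 0 0
    form_e := fun t ht => hN.form_eq_zero_or_eq (hUN ht) (hform_e t ht) }, h0, hinv⟩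

lemma exists_b_eq (h0 : (0 : R2) ∈ N) {η : Fin 2 → ℝ} {j : Fin 2} (hj : η j = 1) {v : Fin 2 → R2}
    (hv : ∀ α β i, C.form α i (S 0) (fderiv ℝ S 0 (v β)) = if α = β then η i else 0) :
    ∃ c : ℝ, ∀ m, ∑ k, ∑ l, ∑ n, C.b m k l n (S 0) * η k * η l * η n = c * η m := by
  have hvj (α β : Fin 2) : C.form α j (S 0) (fderiv ℝ S 0 (v β)) = if α = β then 1 else 0 := by
    rw [hv, hj]
  have hinv : (C.surfaceCoframeMap S j 0).IsInvertible := by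
    have hsurj : Function.Surjective (C.surfaceCoframeMap S j 0) := fun c =>
      ⟨∑ β, c β • v β, funext fun α => by simp [surfaceCoframeMap, hvj, -Fin.sum_univ_two]⟩
    exact ⟨(LinearEquiv.ofInjectiveOfFinrankEq _
      ((LinearMap.injective_iff_surjective_of_finrank_eq_finrank (by simp)).2 hsurj)
      (by simp)).toContinuousLinearEquiv, rfl⟩
  obtain ⟨U, G, h0U⟩ := hN.exists_surfaceFrame h0 hinv
  have hζ (i : Fin 2) : G.ζ i 0 = η i := by
    have hv0 := G.eq_sum_e h0U (v 0)
    simp only [hvj, ite_smul, one_smul, zero_smul, Finset.sum_ite_eq', Finset.mem_univ,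
      if_true] at hv0
    simpa [← hv0, hv] using (G.form_e 0 h0U 0 0 i).symm
  simpa only [hζ] using G.exists_b_eq ⟨0, h0U⟩

end IsGeodesicSurface

end AdaptedCoframe

end ThreeWeb

end GeodesicSurfaces

section Planes

variable {K E : Type*} [Field K] [AddCommGroup E] [Module K E] {u v : E}

lemma finrank_span_pair_of_mem_of_notMem {D : Submodule K E} (hu : u ∈ D) (hu0 : u ≠ 0)
    (hv : v ∉ D) : Module.finrank K (Submodule.span K {u, v}) = 2 := by
  have hli : LinearIndependent K ![u, v] :=
    (LinearIndependent.pair_iff' hu0).2 fun a h => hv (h ▸ D.smul_mem a hu)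
  have h := finrank_span_eq_card hli
  rwa [Matrix.range_cons_cons_empty, Fintype.card_fin] at h

lemma finrank_span_pair_inf_of_mem_of_notMem {D : Submodule K E} (hu : u ∈ D) (hu0 : u ≠ 0)
    (hv : v ∉ D) : Module.finrank K (Submodule.span K {u, v} ⊓ D : Submodule K E) = 1 := by
  have hv0 : v ≠ 0 := fun h => hv (h ▸ D.zero_mem)
  rw [Submodule.span_insert, sup_inf_assoc_of_le _ ((Submodule.span_singleton_le_iff_mem u D).2 hu),
    ((Submodule.disjoint_span_singleton' hv0).2 hv).symm.eq_bot, sup_bot_eq,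
    finrank_span_singleton hu0]

variable {D : Fin 3 → Submodule K E} (hD : ∀ ξ η, ξ ≠ η → Disjoint (D ξ) (D η))
include hD

lemma notMem_of_disjoint {ξ η : Fin 3} (h : ξ ≠ η) (hu : u ∈ D ξ) (hu0 : u ≠ 0) : u ∉ D η :=
  fun hu' => hu0 (Submodule.disjoint_def.1 (hD ξ η h) u hu hu')

lemma finrank_span_pair_inf_of_sub_mem (hu : u ∈ D 0) (hu0 : u ≠ 0) (hv : v ∈ D 1) (hv0 : v ≠ 0)
    (huv : u - v ∈ D 2) (ξ : Fin 3) :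
    Module.finrank K (Submodule.span K {u, v} ⊓ D ξ : Submodule K E) = 1 := by
  fin_cases ξ
  · exact finrank_span_pair_inf_of_mem_of_notMem hu hu0
      (notMem_of_disjoint hD (by decide) hv hv0)
  · rw [Set.pair_comm]
    exact finrank_span_pair_inf_of_mem_of_notMem hv hv0
      (notMem_of_disjoint hD (by decide) hu hu0)
  · have hspan : Submodule.span K {u, v} = Submodule.span K {u - v, v} := by
      refine le_antisymm (Submodule.span_le.2 (Set.pair_subset ?_ ?_))
        (Submodule.span_le.2 (Set.pair_subset ?_ ?_)) <;>
        rw [SetLike.mem_coe, Submodule.mem_span_pair]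
      exacts [⟨1, 1, by module⟩, ⟨0, 1, by module⟩, ⟨1, -1, by module⟩, ⟨0, 1, by module⟩]
    rw [hspan]
    refine finrank_span_pair_inf_of_mem_of_notMem huv (fun h => ?_)
      (notMem_of_disjoint hD (by decide) hv hv0)
    exact notMem_of_disjoint hD (by decide) hu hu0 (sub_eq_zero.1 h ▸ hv : u ∈ D 1)

lemma exists_eq_span_pair_of_finrank_inf {P : Submodule K E} (hP : Module.finrank K P = 2)
    (hPD : ∀ ξ, Module.finrank K (P ⊓ D ξ : Submodule K E) = 1) :
    ∃ u ∈ D 0, ∃ v ∈ D 1, u - v ∈ D 2 ∧ P = Submodule.span K {u, v} := by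
  have : FiniteDimensional K P := Module.finite_of_finrank_eq_succ hP
  have hspan {u v : E} (hu : u ∈ P ⊓ D 0) (hu0 : u ≠ 0) (hv : v ∈ P ⊓ D 1) (hv0 : v ≠ 0) :
      P = Submodule.span K {u, v} :=
    (Submodule.eq_of_le_of_finrank_eq (Submodule.span_le.2 (Set.pair_subset hu.1 hv.1))
      ((finrank_span_pair_of_mem_of_notMem hu.2 hu0
        (notMem_of_disjoint hD (by decide) hv.2 hv0)).trans hP.symm)).symm
  have hex (ξ : Fin 3) : ∃ v ∈ P ⊓ D ξ, v ≠ 0 :=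
    Submodule.exists_mem_ne_zero_of_ne_bot fun h => by
      have h₁ := hPD ξ
      rw [h, finrank_bot] at h₁
      exact zero_ne_one h₁
  choose v hv hv0 using hex
  obtain ⟨a, b, hab⟩ := Submodule.mem_span_pair.1
    ((hspan (hv 0) (hv0 0) (hv 1) (hv0 1)).le (hv 2).1)
  have ha : a • v 0 ∈ P ⊓ D 0 := Submodule.smul_mem _ a (hv 0)
  have hb : -b • v 1 ∈ P ⊓ D 1 := Submodule.smul_mem _ (-b) (hv 1)
  have hsub : a • v 0 - -b • v 1 = v 2 := by rw [neg_smul, sub_neg_eq_add, hab]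
  refine ⟨a • v 0, ha.2, -b • v 1, hb.2, hsub ▸ (hv 2).2, hspan ha (fun h => ?_) hb fun h => ?_⟩
  · rw [h, zero_sub, neg_eq_iff_eq_neg] at hsub
    exact notMem_of_disjoint hD (by decide) (hv 2).2 (hv0 2)
      (neg_mem_iff.1 (hsub ▸ hb.2) : v 2 ∈ D 1)
  · rw [h, sub_zero] at hsub
    exact notMem_of_disjoint hD (by decide) (hv 2).2 (hv0 2) (hsub ▸ ha.2 : v 2 ∈ D 0)

end Planes

section CubicCondition

variable {M : Type*} [TopologicalSpace M] [ChartedSpace R4 M]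

namespace ThreeWeb.AdaptedCoframe

variable {W : ThreeWeb M} (C : W.AdaptedCoframe)

lemma exists_direction {x : M} (hx : x ∈ C.chart.source)
    {P : Submodule ℝ (TangentSpace 𝓘(ℝ, R4) x)} (hP : W.IsTransversalBivector x P) :
    ∃ ξ : Fin 2 → ℝ, ∀ α, ∀ v ∈ P, ∃ s : ℝ, ∀ i,
      C.form α i (C.chart x) (mfderiv 𝓘(ℝ, R4) 𝓘(ℝ, R4) C.chart x v) = s * ξ i := by
  obtain ⟨u, hu, v, hv, huv, rfl⟩ :=
    exists_eq_span_pair_of_finrank_inf (W.transversal x) hP.1 hP.2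
  let φ (α i : Fin 2) : TangentSpace 𝓘(ℝ, R4) x →ₗ[ℝ] ℝ := (C.form α i (C.chart x)).toLinearMap ∘ₗ
    (mfderiv 𝓘(ℝ, R4) 𝓘(ℝ, R4) C.chart x).toLinearMap
  have hu (i : Fin 2) : φ 0 i u = 0 := (C.mem_dist₁ x hx u).1 hu i
  have hv (i : Fin 2) : φ 1 i v = 0 := (C.mem_dist₂ x hx v).1 hv i
  have huv (i : Fin 2) : φ 0 i v = φ 1 i u := by
    have h : φ 0 i (u - v) + φ 1 i (u - v) = 0 := neg_eq_zero.1 ((C.mem_dist₃ x hx _).1 huv i)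
    rw [map_sub, map_sub, hu, hv] at h
    linarith
  refine ⟨fun i => φ 1 i u, fun α w hw => ?_⟩
  obtain ⟨c, d, rfl⟩ := Submodule.mem_span_pair.1 hw
  refine ⟨![d, c] α, fun i => (?_ : φ α i (c • u + d • v) = _)⟩
  fin_cases α <;> simp [hu, hv, huv]

lemma fderiv_chart_comp {s : R2 → M} {t : R2} (hs : ContMDiffAt 𝓘(ℝ, R2) 𝓘(ℝ, R4) ∞ s t)
    (ht : s t ∈ C.chart.source) (v : R2) : fderiv ℝ (C.chart ∘ s) t v =
      mfderiv 𝓘(ℝ, R4) 𝓘(ℝ, R4) C.chart (s t) (mfderiv 𝓘(ℝ, R2) 𝓘(ℝ, R4) s t v) := by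
  rw [← mfderiv_eq_fderiv, mfderiv_comp t
    ((contMDiffAt_of_mem_maximalAtlas C.chart_mem ht).mdifferentiableAt (by simp))
    (hs.mdifferentiableAt (by simp))]
  rfl

lemma isGeodesicSurface_chart_comp {N : Set R2} (hN : IsOpen N) {s : R2 → M}
    (hs : W.IsTransversallyGeodesicSurface N s) :
    C.IsGeodesicSurface (N ∩ s ⁻¹' C.chart.source) (C.chart ∘ s) where
  isOpen := hs.1.continuousOn.isOpen_inter_preimage hN C.chart.open_source
  smooth t ht := ((contMDiffAt_of_mem_maximalAtlas C.chart_mem ht.2).comp t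
    (hs.1.contMDiffAt (hN.mem_nhds ht.1))).contDiffAt.contDiffWithinAt
  mapsTo _ ht := C.chart.map_source ht.2
  exists_direction t ht := by
    obtain ⟨ξ, hξ⟩ := C.exists_direction ht.2 (hs.2 t ht.1)
    refine ⟨ξ, fun α v => ?_⟩
    rw [C.fderiv_chart_comp (hs.1.contMDiffAt (hN.mem_nhds ht.1)) ht.2]
    exact hξ α _ (LinearMap.mem_range_self _ v)

lemma exists_isGeodesicSurface (hW : W.IsTransversallyGeodesic) {x : M} (hx : x ∈ C.chart.source)
    {P : Submodule ℝ (TangentSpace 𝓘(ℝ, R4) x)} (hP : W.IsTransversalBivector x P) :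
    ∃ (N : Set R2) (S : R2 → R4), C.IsGeodesicSurface N S ∧ 0 ∈ N ∧ S 0 = C.chart x ∧
      ∀ v ∈ P, ∃ w : R2, fderiv ℝ S 0 w = mfderiv 𝓘(ℝ, R4) 𝓘(ℝ, R4) C.chart x v := by
  obtain ⟨N, s, rfl, hN, h0, hs, hrange⟩ := hW x P hP
  replace hrange : LinearMap.range (mfderiv 𝓘(ℝ, R2) 𝓘(ℝ, R4) s 0).toLinearMap = P := hrange
  refine ⟨_, _, C.isGeodesicSurface_chart_comp hN hs, ⟨h0, hx⟩, rfl, fun v hv => ?_⟩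
  rw [← hrange] at hv
  obtain ⟨w, rfl⟩ := hv
  exact ⟨w, C.fderiv_chart_comp (hs.1.contMDiffAt (hN.mem_nhds h0)) hx w⟩

lemma form_sum_frame {y : R4} (hy : y ∈ C.chart.target) (ξ : Fin 2 → ℝ) (α β i : Fin 2) :
    C.form α i y (∑ k, ξ k • C.frame β k y) = if α = β then ξ i else 0 := by
  fin_cases α <;> fin_cases β <;> fin_cases i <;> simp [Fin.sum_univ_two, C.form_frame hy]

lemma isTransversalBivector_span {y : R4} (hy : y ∈ C.chart.target) {ξ : Fin 2 → ℝ} (hξ : ξ ≠ 0) :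
    W.IsTransversalBivector (C.chart.symm y) (Submodule.span ℝ
      {mfderiv 𝓘(ℝ, R4) 𝓘(ℝ, R4) C.chart.symm y (∑ k, ξ k • C.frame 1 k y),
        mfderiv 𝓘(ℝ, R4) 𝓘(ℝ, R4) C.chart.symm y (∑ k, ξ k • C.frame 0 k y)}) := by
  have hform := C.form_sum_frame hy ξ
  have hne (β : Fin 2) :
      mfderiv 𝓘(ℝ, R4) 𝓘(ℝ, R4) C.chart.symm y (∑ k, ξ k • C.frame β k y) ≠ 0 := fun h => by
    have hzero : ∑ k, ξ k • C.frame β k y = 0 := (C.mfderiv_chart_symm hy _).symm.trans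
      ((congrArg (mfderiv 𝓘(ℝ, R4) 𝓘(ℝ, R4) C.chart (C.chart.symm y)) h).trans (map_zero _))
    exact hξ (funext fun i => by simpa [hzero] using (hform β β i).symm)
  have hmem₀ := (C.mem_dist_symm 0 hy (∑ k, ξ k • C.frame 1 k y)).2 (hform 0 1)
  have hmem₁ := (C.mem_dist_symm 1 hy (∑ k, ξ k • C.frame 0 k y)).2 (hform 1 0)
  have hmem₂ := (C.mem_dist_symm 2 hy
    (∑ k, ξ k • C.frame 1 k y - ∑ k, ξ k • C.frame 0 k y)).2 fun i => by
      rw [distForm, neg_apply, add_apply, map_sub, map_sub, hform, hform, hform, hform]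
      simp
  have hdisj := W.transversal (C.chart.symm y)
  have hsub := map_sub (mfderiv 𝓘(ℝ, R4) 𝓘(ℝ, R4) C.chart.symm y)
    (∑ k, ξ k • C.frame 1 k y) (∑ k, ξ k • C.frame 0 k y)
  exact ⟨finrank_span_pair_of_mem_of_notMem hmem₀ (hne 1)
    (notMem_of_disjoint hdisj (by decide) hmem₁ (hne 0)),
    finrank_span_pair_inf_of_sub_mem hdisj hmem₀ (hne 1) hmem₁ (hne 0) (hsub ▸ hmem₂)⟩

lemma exists_b_eq_of_isTransversallyGeodesic (hW : W.IsTransversallyGeodesic) {y : R4}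
    (hy : y ∈ C.chart.target) (ξ : Fin 2 → ℝ) :
    ∃ c : ℝ, ∀ m, ∑ k, ∑ l, ∑ n, C.b m k l n y * ξ k * ξ l * ξ n = c * ξ m := by
  obtain rfl | hξ := eq_or_ne ξ 0
  · exact ⟨0, by simp⟩
  obtain ⟨j, hj : ξ j ≠ 0⟩ := Function.ne_iff.1 hξ
  obtain ⟨N, S, hN, h0, hS0, hrange⟩ := C.exists_isGeodesicSurface hW (C.chart.map_target hy)
    (C.isTransversalBivector_span hy hξ)
  rw [C.chart.right_inv hy] at hS0
  have hex (β : Fin 2) : ∃ w : R2, fderiv ℝ S 0 w = ∑ k, ξ k • C.frame β k y := by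
    obtain ⟨w, hw⟩ := hrange
      (mfderiv 𝓘(ℝ, R4) 𝓘(ℝ, R4) C.chart.symm y (∑ k, ξ k • C.frame β k y))
      (Submodule.subset_span (by fin_cases β <;> simp))
    exact ⟨w, hw.trans (C.mfderiv_chart_symm hy _)⟩
  choose w hw using hex
  obtain ⟨c, hc⟩ := hN.exists_b_eq h0 (η := fun i => (ξ j)⁻¹ * ξ i) (inv_mul_cancel₀ hj)
    (v := fun β => (ξ j)⁻¹ • w β) fun α β i => by
      rw [map_smul, hw, map_smul, hS0, C.form_sum_frame hy, smul_eq_mul, mul_ite, mul_zero]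
  refine ⟨ξ j ^ 2 * c, fun m => ?_⟩
  have hm := hc m
  simp only [hS0, Fin.sum_univ_two] at hm ⊢
  field_simp at hm
  linear_combination hm

lemma b_eq_zero_of_isTransversallyGeodesic (hW : W.IsTransversallyGeodesic) {y : R4}
    (hy : y ∈ C.chart.target) {i j : Fin 2} (hij : i ≠ j) : C.b i j j j y = 0 := by
  obtain ⟨c, hc⟩ := C.exists_b_eq_of_isTransversallyGeodesic hW hy (Pi.single j 1)
  simpa [Pi.single_apply, hij] using hc i

end ThreeWeb.AdaptedCoframe

end CubicCondition

section Nonisoclinic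

open TopologicalSpace smoothFunctions

lemma eq_zero_of_cubic_eq_zero {a b c d : ℝ} (h : ∀ t : ℝ, a + b * t + c * t ^ 2 + d * t ^ 3 = 0) :
    a = 0 ∧ b = 0 ∧ c = 0 ∧ d = 0 := by
  have h₀ := h 0
  have h₁ := h 1
  have h₂ := h (-1)
  have h₃ := h 2
  norm_num at h₀ h₁ h₂ h₃
  refine ⟨?_, ?_, ?_, ?_⟩ <;> linarith

variable {M : Type*} [TopologicalSpace M] [ChartedSpace R4 M]

namespace ThreeWeb.AdaptedCoframe

variable {W : ThreeWeb M} (C : W.AdaptedCoframe)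

lemma contDiffOn_pfaffian (i α j : Fin 2) :
    ContDiffOn ℝ ∞ (fun y => fderiv ℝ (C.a i) y (C.frame α j y)
      - ∑ m, C.a m y * C.conn i m y (C.frame α j y)) C.chart.target :=
  (contDiffOn_fderiv_apply C.chart.open_target (C.contDiffOn_a i) (C.contDiffOn_frame α j)).sub
    (ContDiffOn.sum fun m _ =>
      (C.contDiffOn_a m).mul ((C.contDiffOn_conn i m).clm_apply (C.contDiffOn_frame α j)))

section

variable {σ : Equiv.Perm (Fin 2)}
  (hb : ∀ j k l : Fin 2, ∀ y ∈ C.chart.target, C.b (σ 0) j k l y = 0)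
  (hW : W.IsTransversallyGeodesic)
include hb hW

lemma sum_b_eq_zero {y : R4} (hy : y ∈ C.chart.target) (ξ : Fin 2 → ℝ) (hξ : ξ 0 = 1) :
    ∑ k, ∑ l, ∑ n, C.b (σ 1) (σ k) (σ l) (σ n) y * ξ k * ξ l * ξ n = 0 := by
  obtain ⟨c, hc⟩ := C.exists_b_eq_of_isTransversallyGeodesic hW hy (ξ ∘ σ.symm)
  have hc₀ : c = 0 := by simpa [hb _ _ _ y hy, hξ, eq_comm] using hc (σ 0)
  have hc₁ := hc (σ 1)
  rw [hc₀, zero_mul] at hc₁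
  rw [← hc₁]
  refine Eq.trans (Finset.sum_congr rfl fun k _ => ?_) (Equiv.sum_comp σ _)
  refine Eq.trans (Finset.sum_congr rfl fun l _ => ?_) (Equiv.sum_comp σ _)
  refine Eq.trans (Finset.sum_congr rfl fun n _ => ?_) (Equiv.sum_comp σ _)
  simp only [Function.comp_apply, Equiv.symm_apply_apply]

lemma isSpecial_relabel_webFrame (V : Opens R4) (hV : (V : Set R4) ⊆ C.chart.target) :
    ((C.webFrame V hV).relabel σ).IsSpecial := by
  have heval (i j k l : Fin 2) (y : V) : eval y (((C.webFrame V hV).relabel σ).b i j k l) =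
      C.b (σ i) (σ j) (σ k) (σ l) y := by
    rw [WebFrame.relabel_b, eval_webFrame_b]
  have hcoeff (y : V) := eq_zero_of_cubic_eq_zero
    (a := C.b (σ 1) (σ 0) (σ 0) (σ 0) y)
    (b := C.b (σ 1) (σ 0) (σ 0) (σ 1) y + C.b (σ 1) (σ 0) (σ 1) (σ 0) y
      + C.b (σ 1) (σ 1) (σ 0) (σ 0) y)
    (c := C.b (σ 1) (σ 0) (σ 1) (σ 1) y + C.b (σ 1) (σ 1) (σ 0) (σ 1) y
      + C.b (σ 1) (σ 1) (σ 1) (σ 0) y)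
    (d := C.b (σ 1) (σ 1) (σ 1) (σ 1) y) fun t => by
      have h := C.sum_b_eq_zero hb hW (hV y.2) ![1, t] rfl
      simp only [Fin.sum_univ_two, Matrix.cons_val_zero, Matrix.cons_val_one] at h
      linear_combination h
  exact {
    b_zero := fun j k l => ext_eval fun y => by
      rw [heval, hb _ _ _ _ (hV y.2), map_zero]
    b_one_zero := ext_eval fun y => by rw [heval, (hcoeff y).1, map_zero]
    b_one_one := ext_eval fun y => by rw [heval, (hcoeff y).2.2.2, map_zero]
    b_sum_zero := ext_eval fun y => by
      simp only [map_add, heval, (hcoeff y).2.1, map_zero]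
    b_sum_one := ext_eval fun y => by
      simp only [map_add, heval, (hcoeff y).2.2.1, map_zero] }

lemma p_and_q_eq_zero {y : R4} (hy : y ∈ C.chart.target) (j : Fin 2) :
    C.p (σ 1) j y = 0 ∧ C.q (σ 1) j y = 0 := by
  let T : Opens R4 := ⟨C.chart.target, C.chart.open_target⟩
  have h := (C.isSpecial_relabel_webFrame hb hW T subset_rfl).covA_one
  have hzero (r : Fin 2 ⊕ Fin 2) :
      eval (⟨y, hy⟩ : T) ((C.webFrame T subset_rfl).covA (σ 1) (Sum.map σ σ r)) = 0 := by
    rw [← WebFrame.relabel_covA, h, Pi.zero_apply, map_zero]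
  constructor
  · simpa [eval_webFrame_covA_inl] using hzero (.inl (σ.symm j))
  · simpa [eval_webFrame_covA_inr] using hzero (.inr (σ.symm j))

lemma p_sq_add_q_sq_eq_zero {y : R4} (hy : y ∈ C.chart.target) :
    C.p (σ 0) (σ 1) y ^ 2 + C.q (σ 0) (σ 1) y ^ 2 = 0 := by
  let δ (y : R4) : ℝ := C.p (σ 0) (σ 1) y ^ 2 + C.q (σ 0) (σ 1) y ^ 2
  have hδ : ContDiffOn ℝ ∞ δ C.chart.target :=
    ((C.contDiffOn_pfaffian _ 0 _).pow 2).add ((C.contDiffOn_pfaffian _ 1 _).pow 2)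
  let V : Opens R4 := ⟨C.chart.target ∩ δ ⁻¹' {0}ᶜ,
    hδ.continuousOn.isOpen_inter_preimage C.chart.open_target isOpen_compl_singleton⟩
  have hV : (V : Set R4) ⊆ C.chart.target := Set.inter_subset_left
  by_contra hy0
  have : Nonempty V := ⟨⟨y, hy, hy0⟩⟩
  have hδinv : ContDiffOn ℝ ∞ (fun y => (δ y)⁻¹) V := (hδ.mono hV).inv fun y hy => hy.2
  refine (C.isSpecial_relabel_webFrame hb hW V hV).not_isUnit
    (IsUnit.of_mul_eq_one (smoothFunctions.mk _ hδinv) (ext_eval fun z => ?_))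
  simp only [WebFrame.relabel_covA, Sum.map_inl, Sum.map_inr, map_mul, map_add, map_pow, map_one,
    eval_webFrame_covA_inl, eval_webFrame_covA_inr, eval_mk]
  exact mul_inv_cancel₀ z.2.2

end

lemma not_isNonisoclinicAt (hW : W.IsTransversallyGeodesic) {i : Fin 2}
    (hb : ∀ j k l, ∀ y ∈ C.chart.target, C.b i j k l y = 0) {y : R4}
    (hy : y ∈ C.chart.target) : ¬ C.IsNonisoclinicAt y := by
  let σ : Equiv.Perm (Fin 2) := Equiv.swap 0 i
  have hbσ (j k l : Fin 2) : ∀ y ∈ C.chart.target, C.b (σ 0) j k l y = 0 := by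
    simpa [σ] using hb j k l
  have hpq := C.p_and_q_eq_zero hbσ hW hy (σ 0)
  have hsq := C.p_sq_add_q_sq_eq_zero hbσ hW hy
  rw [IsNonisoclinicAt, not_lt]
  fin_cases i <;> simp [σ] at hpq hsq ⊢ <;> simp only [hpq] <;> linarith

end ThreeWeb.AdaptedCoframe

end Nonisoclinic

end

theorem corollary8 {M : Type*} [TopologicalSpace M] [ChartedSpace R4 M]
    [IsManifold 𝓘(ℝ, R4) ∞ M] (W : ThreeWeb M) (C : W.AdaptedCoframe) :
    (∀ i j : Fin 2, i ≠ j → ∀ y ∈ C.chart.target, C.b i j j j y ≠ 0 →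
      ¬ W.IsTransversallyGeodesic) ∧
    ((∃ y ∈ C.chart.target, C.IsNonisoclinicAt y) →
      ¬ W.IsGroupWeb →
      ((∀ j k l : Fin 2, ∀ y ∈ C.chart.target, C.b 0 j k l y = 0) ∨
        (∀ j k l : Fin 2, ∀ y ∈ C.chart.target, C.b 1 j k l y = 0)) →
      ¬ W.IsTransversallyGeodesic) := by
  refine ⟨fun i j hij y hy hb hW => hb (C.b_eq_zero_of_isTransversallyGeodesic hW hy hij), ?_⟩
  rintro ⟨y, hy, hiso⟩ - (hb | hb) hW
  · exact C.not_isNonisoclinicAt hW hb hy hiso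
  · exact C.not_isNonisoclinicAt hW hb hy hiso
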